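/- Let $G=\mathrm{SL}(3,\mathbb{R})$, let $P\subset G$ be the minimal parabolic subgroup of upper triangular matrices, and let $$a=\begin{bmatrix}1&1&2\\0&1&1\\0&-3&-2\end{bmatrix},\qquad b=\begin{bmatrix}-2&0&-1\\-5&1&-1\\3&0&1\end{bmatrix}\in\mathrm{SL}(3,\mathbb{Z}).$$ Let $\Gamma=\langle a,b\rangle$ be the subgroup of $\mathrm{SL}(3,\mathbb{Z})\subset G$ generated by $a$ and $b$. Then: 1. $\Gamma$ is the image of the $(3,3,4)$ triangle group $\langle x,y\mid x^3=y^3=(xy)^4=1\rangle$ under a homomorphism with $x\mapsto a$, $y\mapsto b$. 2. $\Gamma$ acts minimally on the Furstenberg boundary $G/P$, i.e. every $\Gamma$-orbit in $G/P$ is dense. 3. $\Gamma$ is not an Anosov subgroup of $G$. Here a finitely generated subgroup $\Delta\subset G$ is called Anosov if there are constants $L\ge 1$ and $A\ge 0$ such that $\alpha(\mu(\gamma))\ge \frac1L|\gamma|-A$ for all $\gamma\in\Delta$ and both simple roots $\alpha$, where $|\cdot|$ is the word length for some finite generating set of $\Delta$, $\mu(\gamma)=(\mu_1\ge\mu_2\ge\mu_3)$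 with $\mu_1+\mu_2+\mu_3=0$ is the Cartan projection, determined by $\gamma\in \mathrm{SO}(3)\,\mathrm{diag}(e^{\mu_1},e^{\mu_2},e^{\mu_3})\,\mathrm{SO}(3)$, and the simple roots are $\mu\mapsto\mu_1-\mu_2$ and $\mu\mapsto\mu_2-\mu_3$. 4. The element of $\Gamma$ given by the reduced word of length $18$ $$w=ba^{-1}ba^{-1}ba^{-1}ba^{-1}b^{-1}aba^{-1}ba^{-1}b^{-1}aba^{-1}$$ has infinite order and has a non-real eigenvalue. -/

import Mathlib

open Matrix

/-- The Lie group `G = SL(3, ℝ)`, with the topology induced from `3 × 3` matrices. -/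
abbrev SL3R : Type := Matrix.SpecialLinearGroup (Fin 3) ℝ

/-- The inclusion of `SL(3, ℤ)` into `SL(3, ℝ)`. -/
abbrev inclSL3Z : Matrix.SpecialLinearGroup (Fin 3) ℤ →* SL3R :=
  Matrix.SpecialLinearGroup.map (Int.castRingHom ℝ)

/-! ### The Furstenberg boundary -/

/-- The standard minimal parabolic subgroup `P` of `SL(3, ℝ)`: upper triangular matrices. -/
def minParabolic : Subgroup SL3R where
  carrier := {g | ∀ i j : Fin 3, j < i → (g : Matrix (Fin 3) (Fin 3) ℝ) i j = 0}
  one_mem' := by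
    intro i j hij
    simp [Matrix.one_apply_ne hij.ne']
  mul_mem' := by
    intro g h hg hh
    have hg' : (g : Matrix (Fin 3) (Fin 3) ℝ).BlockTriangular id := fun i j hij => hg i j hij
    have hh' : (h : Matrix (Fin 3) (Fin 3) ℝ).BlockTriangular id := fun i j hij => hh i j hij
    intro i j hij
    rw [Matrix.SpecialLinearGroup.coe_mul]
    exact (hg'.mul hh') hij
  inv_mem' := by
    intro g hg i j hij
    have hg' : (g : Matrix (Fin 3) (Fin 3) ℝ).BlockTriangular id := fun i j hij => hg i j hij
    have hu : IsUnit (g : Matrix (Fin 3) (Fin 3) ℝ).det := by simp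
    have := Matrix.invertibleOfIsUnitDet _ hu
    have h := Matrix.blockTriangular_inv_of_blockTriangular hg'
    have e : ((g⁻¹ : SL3R) : Matrix (Fin 3) (Fin 3) ℝ) = (g : Matrix (Fin 3) (Fin 3) ℝ)⁻¹ := by
      rw [Matrix.SpecialLinearGroup.coe_inv, Matrix.inv_def]
      simp
    rw [e]
    exact h hij

/-- The Furstenberg boundary `G / P` of `SL(3, ℝ)`, with the quotient topology and the action of
`G` by left translation. -/
abbrev FurstenbergBoundary : Type := SL3R ⧸ minParabolic

/-! ### The Cartan projection -/

/-- `H = (H 0, H 1, H 2)` is an element of the closed positive Weyl chamber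
(`H 0 ≥ H 1 ≥ H 2`, `H 0 + H 1 + H 2 = 0`) with `g ∈ K exp(H) K`, where `K = SO(3)`. -/
def IsCartanProjection (g : SL3R) (H : Fin 3 → ℝ) : Prop :=
  Antitone H ∧ ∑ i, H i = 0 ∧
    ∃ k₁ ∈ Matrix.specialOrthogonalGroup (Fin 3) ℝ,
      ∃ k₂ ∈ Matrix.specialOrthogonalGroup (Fin 3) ℝ,
        (g : Matrix (Fin 3) (Fin 3) ℝ) = k₁ * Matrix.diagonal (fun i => Real.exp (H i)) * k₂

theorem exists_isCartanProjection (g : SL3R) : ∃ H, IsCartanProjection g H := by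
  set M : Matrix (Fin 3) (Fin 3) ℝ := g.1 with hM
  have hdet : M.det = 1 := g.2
  have hinj : Function.Injective M.mulVec := by
    rw [Matrix.mulVec_injective_iff_isUnit, Matrix.isUnit_iff_isUnit_det]
    simp [hdet]
  have hpd : (Mᴴ * M).PosDef := Matrix.PosDef.conjTranspose_mul_self M hinj
  obtain ⟨U, d, hU, hdpos, hspec⟩ : ∃ (U : Matrix (Fin 3) (Fin 3) ℝ) (d : Fin 3 → ℝ),
      Uᵀ * U = 1 ∧ (∀ i, 0 < d i) ∧ Mᵀ * M = U * diagonal d * Uᵀ := by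
    refine ⟨hpd.1.eigenvectorUnitary, hpd.1.eigenvalues, ?_, fun i => hpd.eigenvalues_pos i, ?_⟩
    · have := (Matrix.mem_unitaryGroup_iff' (A := (hpd.1.eigenvectorUnitary :
        Matrix (Fin 3) (Fin 3) ℝ))).1 hpd.1.eigenvectorUnitary.2
      simpa [Matrix.star_eq_conjTranspose] using this
    · have := hpd.1.spectral_theorem
      simpa [Matrix.star_eq_conjTranspose, Unitary.conjStarAlgAut_apply, Function.comp_def]
        using this
  set e : Equiv.Perm (Fin 3) := Fin.revPerm.trans (Tuple.sort d) with he
  have hanti : Antitone (d ∘ e) := by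
    intro i j hij
    exact Tuple.monotone_sort d (Fin.rev_le_rev.2 hij)
  set V : Matrix (Fin 3) (Fin 3) ℝ := U.submatrix id e with hV
  have hVV : Vᵀ * V = 1 := by
    rw [hV, Matrix.transpose_submatrix, ← Matrix.submatrix_mul _ _ _ _ _ Function.bijective_id, hU]
    simp
  have hVV' : V * Vᵀ = 1 := mul_eq_one_comm.1 hVV
  have hspecV : Mᵀ * M = V * diagonal (d ∘ e) * Vᵀ := by
    rw [hspec, hV, ← Matrix.submatrix_diagonal_equiv, Matrix.transpose_submatrix,
      Matrix.submatrix_mul_equiv, Matrix.submatrix_mul_equiv]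
    simp
  have hsq : V.det * V.det = 1 := by
    have := congrArg Matrix.det hVV
    simpa [Matrix.det_mul] using this
  have hprod : ∏ i, (d ∘ e) i = 1 := by
    have := congrArg Matrix.det hspecV
    rw [Matrix.det_mul, Matrix.det_mul, Matrix.det_mul, Matrix.det_transpose, Matrix.det_transpose,
      hdet, Matrix.det_diagonal] at this
    linear_combination (∏ i, (d ∘ e) i) * (- hsq) - this
  set H : Fin 3 → ℝ := fun i => Real.log ((d ∘ e) i) / 2 with hH
  have hHsum : ∑ i, H i = 0 := by
    rw [hH, ← Finset.sum_div, ← Real.log_prod (f := d ∘ e) (fun i _ => (hdpos (e i)).ne'), hprod]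
    simp
  have hHexp : ∀ i, Real.exp (H i) * Real.exp (H i) = (d ∘ e) i := by
    intro i
    rw [← Real.exp_add, hH]
    simp only [add_halves]
    exact Real.exp_log (hdpos (e i))
  set E : Matrix (Fin 3) (Fin 3) ℝ := diagonal (fun i => Real.exp (H i)) with hE
  set E' : Matrix (Fin 3) (Fin 3) ℝ := diagonal (fun i => Real.exp (-H i)) with hE'
  have hEE : E' * E = 1 := by
    rw [hE, hE', Matrix.diagonal_mul_diagonal]
    simp [← Real.exp_add]
  have hdetE' : E'.det = 1 := by
    rw [hE', Matrix.det_diagonal, ← Real.exp_sum]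
    simp [hHsum]
  have hEd : E' * diagonal (d ∘ e) * E' = 1 := by
    have : diagonal (d ∘ e) = E * E := by
      rw [hE, Matrix.diagonal_mul_diagonal]
      congr 1
      funext i
      exact (hHexp i).symm
    rw [this]
    have h2 : E * E' = 1 := mul_eq_one_comm.1 hEE
    rw [← mul_assoc, hEE, one_mul, h2]
  have hE'T : E'ᵀ = E' := by rw [hE', Matrix.diagonal_transpose]
  refine ⟨H, ?_, hHsum, V.det • (M * V * E'), ?_, V.det • Vᵀ, ?_, ?_⟩
  · intro i j hij
    have := Real.log_le_log (hdpos (e j)) (hanti hij)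
    simp only [hH]
    simp only [Function.comp_apply] at this ⊢
    linarith
  · rw [Matrix.mem_specialOrthogonalGroup_iff, Matrix.mem_orthogonalGroup_iff']
    constructor
    · have : (M * V * E')ᵀ * (M * V * E') = 1 := by
        calc (M * V * E')ᵀ * (M * V * E') = E' * (Vᵀ * (Mᵀ * M) * V) * E' := by
              simp only [Matrix.transpose_mul, hE'T, mul_assoc]
          _ = E' * ((Vᵀ * V) * diagonal (d ∘ e) * (Vᵀ * V)) * E' := by
              rw [hspecV]; simp only [mul_assoc]
          _ = 1 := by rw [hVV, one_mul, mul_one, hEd]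
      rw [Matrix.transpose_smul, Matrix.smul_mul, Matrix.mul_smul, this, smul_smul, hsq, one_smul]
    · rw [Matrix.det_smul, Matrix.det_mul, Matrix.det_mul, hdet, hdetE']
      simp only [Fintype.card_fin]
      linear_combination (V.det * V.det + 1) * hsq
  · rw [Matrix.mem_specialOrthogonalGroup_iff, Matrix.mem_orthogonalGroup_iff']
    constructor
    · rw [Matrix.transpose_smul, Matrix.smul_mul, Matrix.mul_smul, Matrix.transpose_transpose, hVV',
        smul_smul, hsq, one_smul]
    · rw [Matrix.det_smul, Matrix.det_transpose]
      simp only [Fintype.card_fin]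
      linear_combination (V.det * V.det + 1) * hsq
  · rw [Matrix.smul_mul, Matrix.smul_mul, Matrix.mul_smul, smul_smul, hsq, one_smul,
      mul_assoc (M * V) E' E, hEE, mul_one, mul_assoc, hVV', mul_one]

theorem IsCartanProjection.unique {g : SL3R} {H H' : Fin 3 → ℝ}
    (h : IsCartanProjection g H) (h' : IsCartanProjection g H') : H = H' := by
  have key : ∀ {L : Fin 3 → ℝ}, IsCartanProjection g L →
      ((g : Matrix (Fin 3) (Fin 3) ℝ)ᵀ * (g : Matrix (Fin 3) (Fin 3) ℝ)).charpoly.roots =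
        Multiset.map (fun i => Real.exp (L i) * Real.exp (L i)) Finset.univ.val := by
    rintro L ⟨-, -, k₁, hk₁, k₂, hk₂, hg⟩
    rw [Matrix.mem_specialOrthogonalGroup_iff] at hk₁ hk₂
    have h1 : k₁ᵀ * k₁ = 1 := by
      simpa [Matrix.star_eq_conjTranspose] using (Matrix.mem_orthogonalGroup_iff' ..).1 hk₁.1
    have h2 : k₂ * k₂ᵀ = 1 := by
      simpa [Matrix.star_eq_conjTranspose] using (Matrix.mem_orthogonalGroup_iff ..).1 hk₂.1
    have hc : ((g : Matrix (Fin 3) (Fin 3) ℝ)ᵀ * (g : Matrix (Fin 3) (Fin 3) ℝ)) =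
        k₂ᵀ * (diagonal (fun i => Real.exp (L i) * Real.exp (L i)) * k₂) := by
      rw [hg, ← Matrix.diagonal_mul_diagonal]
      simp only [Matrix.transpose_mul, Matrix.diagonal_transpose]
      calc _ = k₂ᵀ * (diagonal (fun i => Real.exp (L i)) * (k₁ᵀ * k₁) *
            diagonal (fun i => Real.exp (L i)) * k₂) := by simp only [mul_assoc]
        _ = _ := by rw [h1, mul_one]
    rw [hc, Matrix.charpoly_mul_comm, mul_assoc, h2, mul_one, Matrix.charpoly_diagonal]
    exact Polynomial.roots_multiset_prod_X_sub_C
      (Multiset.map (fun i => Real.exp (L i) * Real.exp (L i)) Finset.univ.val) ▸ by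
        rw [Multiset.map_map]; rfl
  have hmap := (key h).symm.trans (key h')
  have hmap2 : Multiset.map H Finset.univ.val = Multiset.map H' Finset.univ.val := by
    have := congrArg (Multiset.map (fun x => Real.log x / 2)) hmap
    rw [Multiset.map_map, Multiset.map_map] at this
    have e : ∀ L : Fin 3 → ℝ,
        ((fun x => Real.log x / 2) ∘ fun i => Real.exp (L i) * Real.exp (L i)) = L := by
      intro L
      funext i
      simp [← Real.exp_add]
    rwa [e, e] at this
  rw [Fin.univ_val_map, Fin.univ_val_map, Multiset.coe_eq_coe] at hmap2
  exact List.ofFn_injective (hmap2.eq_of_sortedGE h.1.sortedGE_ofFn h'.1.sortedGE_ofFn)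

/-- The Cartan projection `μ(g)` of `g`: the unique `H` in the closed positive Weyl chamber with
`g ∈ K exp(H) K`. -/
noncomputable def cartanProjection (g : SL3R) : Fin 3 → ℝ :=
  (exists_isCartanProjection g).choose

theorem cartanProjection_spec (g : SL3R) : IsCartanProjection g (cartanProjection g) :=
  (exists_isCartanProjection g).choose_spec

/-- The two simple roots `H ↦ H 0 - H 1` and `H ↦ H 1 - H 2`. -/
def simpleRoot (α : Fin 2) (H : Fin 3 → ℝ) : ℝ := H α.castSucc - H α.succ

/-! ### Anosov subgroups -/

/-- The word length of `γ` with respect to `S`: the least length of an expression of `γ` as a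
product of elements of `S` and their inverses. -/
noncomputable def wordLength {Γ : Type*} [Group Γ] (S : Set Γ) (γ : Γ) : ℕ :=
  sInf {n : ℕ | ∃ l : List Γ, l.length = n ∧ (∀ x ∈ l, x ∈ S ∨ x⁻¹ ∈ S) ∧ l.prod = γ}

/-- A finitely generated subgroup `Γ` of `SL(3, ℝ)` is Anosov (with respect to the minimal parabolic
subgroup) if, for a word length `|·|` on `Γ` given by a finite generating set, there are `L ≥ 1`
and `A ≥ 0` with `α(μ(γ)) ≥ |γ| / L - A` for all simple roots `α` and all `γ ∈ Γ`. -/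
def IsAnosov (Γ : Subgroup SL3R) : Prop :=
  ∃ S : Finset Γ, Subgroup.closure (S : Set Γ) = ⊤ ∧
    ∃ L A : ℝ, 1 ≤ L ∧ 0 ≤ A ∧ ∀ (α : Fin 2) (γ : Γ),
      (1 / L) * (wordLength (S : Set Γ) γ : ℝ) - A ≤ simpleRoot α (cartanProjection (γ : SL3R))

/-! ### The example -/

/-- The matrix `a`. -/
def matA : Matrix.SpecialLinearGroup (Fin 3) ℤ :=
  ⟨!![1, 1, 2; 0, 1, 1; 0, -3, -2], by simp [Matrix.det_fin_three]⟩

/-- The matrix `b`. -/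
def matB : Matrix.SpecialLinearGroup (Fin 3) ℤ :=
  ⟨!![-2, 0, -1; -5, 1, -1; 3, 0, 1], by simp [Matrix.det_fin_three]⟩

/-- The subgroup `Γ = ⟨a, b⟩` of `SL(3, ℤ)`. -/
def groupAB : Subgroup (Matrix.SpecialLinearGroup (Fin 3) ℤ) := Subgroup.closure {matA, matB}

/-- The relators `x³`, `y³`, `(xy)⁴` in the free group on `x` (index `0`) and `y` (index `1`). -/
def triangleRels : Set (FreeGroup (Fin 2)) :=
  {FreeGroup.of 0 ^ 3, FreeGroup.of 1 ^ 3, (FreeGroup.of 0 * FreeGroup.of 1) ^ 4}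

/-- The `(3,3,4)` triangle group `⟨x, y ∣ x³ = y³ = (xy)⁴ = 1⟩`. -/
abbrev TriangleGroup334 : Type := PresentedGroup triangleRels

/-- The word `y x⁻¹ y x⁻¹ y x⁻¹ y x⁻¹ y⁻¹ x y x⁻¹ y x⁻¹ y⁻¹ x y x⁻¹`
in `x` (index `0`) and `y` (index `1`). -/
def word18 : FreeGroup (Fin 2) :=
  let x : FreeGroup (Fin 2) := FreeGroup.of 0
  let y : FreeGroup (Fin 2) := FreeGroup.of 1
  y * x⁻¹ * y * x⁻¹ * y * x⁻¹ * y * x⁻¹ * y⁻¹ * x * y * x⁻¹ * y * x⁻¹ * y⁻¹ * x * y * x⁻¹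

/-- The element of `SL(3, ℤ)` obtained from a word by substituting `x = a` and `y = b`. -/
def evalAB : FreeGroup (Fin 2) →* Matrix.SpecialLinearGroup (Fin 3) ℤ :=
  FreeGroup.lift ![matA, matB]

/-! Everything rests on one element, w = `evalAB word18`. Its characteristic polynomial x³ −
603386516x² + 3386x − 1 has a real root l > 1 and a nonreal pair μ, μ̄ with l|μ|² = 1. Integrality
forbids any positive power of μ from being real (`pow_im_ne_zero`). So w expands a line, its axis,
against a plane on which it acts by a scaled rotation of infinite order.

Minimality: a flag is a vector v and a covector f with f·v = 0, and a closed invariant set of flags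
becomes a closed invariant cone of such pairs. Positive powers of w drag the line of a generic flag
to the axis while its plane keeps turning, so the cone contains all flags through the axis
(`IsInvariantCone.axis_mem`). The translates of the axis are dense among lines: negative powers
spread one translate over the eigenplane, and positive powers turn a translate of that plane around
the axis until it sweeps out space (`eq_univ_of_axis_mem`). General position is supplied by
`groupAB_irreducible`. Hence the cone contains every flag (`IsInvariantCone.flag_mem`), and a local
section carries this to G/P (`isMinimal_of_flag_mem`).

Failure of the Anosov property: μ and μ̄ have equal modulus, so one simple root stays bounded on the
powers of w, although these are infinitely many distinct elements and word balls are finite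
(`SpiralCoords.not_isAnosov`). The remaining claims are explicit computations. -/

open Filter Topology

/-! ### Irrational rotations and cubic units. -/

/-- The powers of a unit complex number of infinite order accumulate everywhere on a circle. -/
theorem exists_tendsto_pow_mul {u : ℂ} (hu : ‖u‖ = 1) (hinf : ∀ k : ℕ, 0 < k → u ^ k ≠ 1)
    {z z' : ℂ} (hz : ‖z‖ = ‖z'‖) :
    ∃ φ : ℕ → ℕ, Tendsto φ atTop atTop ∧ Tendsto (fun k => u ^ φ k * z) atTop (𝓝 z') := by
  by_cases hz0 : z = 0
  · subst hz0
    have : z' = 0 := by simpa using hz.symm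
    subst this
    exact ⟨id, tendsto_id, by simp⟩
  have hnz : ‖z‖ ≠ 0 := by simpa using hz0
  let U : Circle := ⟨u, by simpa [Submonoid.unitSphere] using hu⟩
  have hUpow : ∀ n : ℕ, ((U ^ n : Circle) : ℂ) = u ^ n := fun n => Circle.coe_pow U n
  let V : Circle := ⟨z' / z, by simp [Submonoid.unitSphere, ← hz, hnz]⟩
  have : Fact (0 < 2 * Real.pi) := ⟨by positivity⟩
  obtain ⟨θ, hθ⟩ := AddCircle.homeomorphCircle'.surjective U
  have hhom : ∀ x : AddCircle (2 * Real.pi),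
      AddCircle.homeomorphCircle' x = AddCircle.toCircle x := by
    intro x
    induction x using QuotientAddGroup.induction_on with
    | H x => simp [AddCircle.homeomorphCircle'_apply_mk, AddCircle.toCircle_apply_mk]
  have hord : addOrderOf θ = 0 := by
    rw [addOrderOf_eq_zero_iff']
    intro n hn h0
    apply hinf n hn
    have : U ^ n = 1 := by
      rw [← hθ, hhom, ← AddCircle.toCircle_nsmul, h0, AddCircle.toCircle_zero]
    rw [← hUpow, this, Circle.coe_one]
  have hdense : DenseRange (fun n : ℤ => U ^ n) := by
    have h1 := AddCircle.denseRange_zsmul_iff.2 hord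
    have h2 := AddCircle.homeomorphCircle'.surjective.denseRange.comp h1
      AddCircle.homeomorphCircle'.continuous
    have e : (AddCircle.homeomorphCircle' ∘ fun n : ℤ => n • θ) = fun n : ℤ => U ^ n := by
      funext n
      simp only [Function.comp_apply]
      rw [hhom, AddCircle.toCircle_zsmul, ← hhom, hθ]
    rwa [e] at h2
  -- In a compact group the natural powers already accumulate at every point of the closure of the
  -- cyclic group, so exponents tending to +∞ suffice.
  have hcl : MapClusterPt V atTop (U ^ · : ℕ → Circle) := by
    rw [mapClusterPt_atTop_pow_iff_mem_topologicalClosure_zpowers]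
    rw [← SetLike.mem_coe, Subgroup.topologicalClosure_coe, Subgroup.coe_zpowers]
    exact hdense V
  obtain ⟨φ, hφ, hlim⟩ := hcl.tendsto_subseq
  refine ⟨φ, hφ.tendsto_atTop, ?_⟩
  have h3 : Tendsto (fun k => ((U ^ φ k : Circle) : ℂ) * z) atTop (𝓝 ((V : ℂ) * z)) :=
    ((continuous_subtype_val.tendsto V).comp hlim).mul_const z
  have hV : (V : ℂ) * z = z' := by simp [V, hz0]
  rw [hV] at h3
  simpa only [hUpow] using h3

/-- Newton sums of a monic cubic with integer coefficients are integers. -/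
theorem exists_int_power_sum {x y z : ℂ} {s t : ℤ} (hs : x + y + z = s)
    (ht : x * y + y * z + z * x = t) (hn : x * y * z = 1) (n : ℕ) :
    ∃ S : ℤ, x ^ n + y ^ n + z ^ n = S := by
  have hx : x ^ 3 = s * x ^ 2 - t * x + 1 := by rw [← hs, ← ht, ← hn]; ring
  have hy : y ^ 3 = s * y ^ 2 - t * y + 1 := by rw [← hs, ← ht, ← hn]; ring
  have hz : z ^ 3 = s * z ^ 2 - t * z + 1 := by rw [← hs, ← ht, ← hn]; ring
  induction n using Nat.strong_induction_on with
  | _ n ih =>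
    match n with
    | 0 => exact ⟨3, by norm_num⟩
    | 1 => exact ⟨s, by simpa using hs⟩
    | 2 => exact ⟨s ^ 2 - 2 * t, by push_cast; rw [← hs, ← ht]; ring⟩
    | n + 3 =>
      obtain ⟨S2, h2⟩ := ih (n + 2) (by omega)
      obtain ⟨S1, h1⟩ := ih (n + 1) (by omega)
      obtain ⟨S0, h0⟩ := ih n (by omega)
      refine ⟨s * S2 - t * S1 + S0, ?_⟩
      push_cast
      rw [← h2, ← h1, ← h0]
      linear_combination x ^ n * hx + y ^ n * hy + z ^ n * hz

/-- A real double root `m`, with `0 < m ^ 2 < 1`, of an integer cubic with constant term `-1`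
cannot exist. -/
theorem no_double_root {X m : ℝ} {S T : ℤ} (hn : m ^ 2 * X = 1) (hS : X + 2 * m = S)
    (hT : m ^ 2 + 2 * m * X = T) (hX : 1 < X) : False := by
  have hm0 : m ≠ 0 := by rintro rfl; simp at hn
  have hmsq : m ^ 2 < 1 := by
    have : 0 < m ^ 2 := by positivity
    nlinarith
  have hmX : m ≠ X := by
    rintro rfl
    nlinarith
  have hden : ((S : ℝ) ^ 2 - 3 * T) ≠ 0 := by
    rw [← hS, ← hT]
    have : (X + 2 * m) ^ 2 - 3 * (m ^ 2 + 2 * m * X) = (m - X) ^ 2 := by ring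
    rw [this]
    exact pow_ne_zero 2 (sub_ne_zero.2 hmX)
  -- A double root is a common root of the cubic and its derivative. The remainder of the division
  -- is linear, and this quotient is its root.
  have hrat : m = (((S * T - 9 : ℤ) : ℚ) / ((2 * (S ^ 2 - 3 * T) : ℤ) : ℚ) : ℚ) := by
    push_cast
    rw [eq_div_iff (mul_ne_zero two_ne_zero hden)]
    rw [← hS, ← hT]
    linear_combination (-9) * hn
  set q : ℚ := ((S * T - 9 : ℤ) : ℚ) / ((2 * (S ^ 2 - 3 * T) : ℤ) : ℚ)
  have hqroot : q ^ 3 - S * q ^ 2 + T * q - 1 = 0 := by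
    have : ((q : ℝ)) ^ 3 - S * q ^ 2 + T * q - 1 = 0 := by
      rw [← hrat, ← hS, ← hT]
      linear_combination hn
    exact_mod_cast this
  have hint : IsIntegral ℤ q := by
    refine ⟨Polynomial.X ^ 3 - Polynomial.C S * Polynomial.X ^ 2 + Polynomial.C T * Polynomial.X
      - 1, ?_, ?_⟩
    · monicity!
    · simp only [Polynomial.eval₂_sub, Polynomial.eval₂_add, Polynomial.eval₂_mul,
        Polynomial.eval₂_pow, Polynomial.eval₂_X, Polynomial.eval₂_C, Polynomial.eval₂_one]
      exact hqroot
  obtain ⟨k, hk⟩ := IsIntegrallyClosed.isIntegral_iff.1 hint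
  have hmk : m = k := by rw [hrat, ← hk]; simp
  rw [hmk] at hmsq hm0
  have h1 : k ^ 2 < 1 := by exact_mod_cast hmsq
  have h2 : k ≠ 0 := by exact_mod_cast hm0
  have : 0 < k ^ 2 := by positivity
  omega

/-- No positive power of a nonreal eigenvalue of an integral cubic unit is real, if the real
eigenvalue is larger than `1`. -/
theorem pow_im_ne_zero {l : ℝ} {μ : ℂ} {s t : ℤ} (hl : 1 < l) (hs : l + 2 * μ.re = s)
    (ht : 2 * l * μ.re + Complex.normSq μ = t) (hn : l * Complex.normSq μ = 1) {k : ℕ}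
    (hk : 0 < k) : (μ ^ k).im ≠ 0 := by
  intro him
  set c := starRingEnd ℂ μ with hc
  have hadd : μ + c = ((2 * μ.re : ℝ) : ℂ) := Complex.add_conj μ
  have hmul : μ * c = ((Complex.normSq μ : ℝ) : ℂ) := Complex.mul_conj μ
  have hsC : (l : ℂ) + μ + c = s := by
    rw [add_assoc, hadd]; exact_mod_cast hs
  have htC : (l : ℂ) * μ + μ * c + c * l = t := by
    have : (l : ℂ) * μ + μ * c + c * l = l * (μ + c) + μ * c := by ring
    rw [this, hadd, hmul, ← Complex.ofReal_mul, ← Complex.ofReal_add, ← Complex.ofReal_intCast,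
      ← ht]
    congr 1; ring
  have hnC : (l : ℂ) * μ * c = 1 := by
    rw [mul_assoc, hmul]; exact_mod_cast hn
  obtain ⟨S, hS⟩ := exists_int_power_sum hsC htC hnC k
  -- The pairwise products of the roots satisfy the cubic with s and t exchanged, because the
  -- product of the roots is 1. Their k-th power sum is the second symmetric function of the k-th
  -- powers.
  obtain ⟨T, hT⟩ := exists_int_power_sum (x := l * μ) (y := μ * c) (z := c * l) (s := t) (t := s)
    htC (by rw [← hsC]; linear_combination (l + μ + c) * hnC)
    (by linear_combination ((l : ℂ) * μ * c + 1) * hnC) k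
  have hreal : μ ^ k = (((μ ^ k).re : ℝ) : ℂ) := by
    apply Complex.ext <;> simp [him]
  have hreal' : c ^ k = (((μ ^ k).re : ℝ) : ℂ) := by
    rw [hc, ← map_pow, hreal, Complex.conj_ofReal]
    simp
  set m := (μ ^ k).re
  refine no_double_root (X := l ^ k) (m := m) (S := S) (T := T) ?_ ?_ ?_
    (one_lt_pow₀ hl hk.ne')
  · have : ((l : ℂ) * μ * c) ^ k = 1 := by rw [hnC, one_pow]
    rw [mul_pow, mul_pow, hreal, hreal'] at this
    have h : l ^ k * m * m = 1 := by exact_mod_cast this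
    linarith
  · rw [hreal, hreal'] at hS
    have h : l ^ k + m + m = S := by exact_mod_cast hS
    linarith
  · rw [mul_pow, mul_pow, mul_pow, hreal, hreal'] at hT
    have h : l ^ k * m + m * m + m * l ^ k = T := by exact_mod_cast hT
    linarith

/-! ### Coordinates adapted to a real and a complex eigenvalue. -/

/-- Real `3 × 3` matrices. -/
abbrev Mat3 : Type := Matrix (Fin 3) (Fin 3) ℝ

/-- Coordinates `ℝ³ ≃ ℝ × ℂ` on vectors and on covectors, compatible with the duality pairing, in
which `w` acts by a real scalar `l` and a complex scalar `μ`. -/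
structure SpiralCoords (w : SL3R) (l : ℝ) (μ : ℂ) where
  vec : (Fin 3 → ℝ) ≃L[ℝ] ℝ × ℂ
  covec : (Fin 3 → ℝ) ≃L[ℝ] ℝ × ℂ
  pairing : ∀ f v, f ⬝ᵥ v = (covec f).1 * (vec v).1 + ((covec f).2 * (vec v).2).re
  vec_mulVec : ∀ v, vec ((w : Mat3) *ᵥ v) = (l * (vec v).1, μ * (vec v).2)

namespace SpiralCoords

/-- Coordinates on vectors determine dual coordinates on covectors. -/
noncomputable def ofVec {w : SL3R} {l : ℝ} {μ : ℂ} (Φ : (Fin 3 → ℝ) ≃L[ℝ] ℝ × ℂ)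
    (hΦ : ∀ v, Φ ((w : Mat3) *ᵥ v) = (l * (Φ v).1, μ * (Φ v).2)) : SpiralCoords w l μ := by
  let Λ : ℝ × ℂ →ₗ[ℝ] (Fin 3 → ℝ) :=
    { toFun := fun q j => q.1 * (Φ (Pi.single j 1)).1 + (q.2 * (Φ (Pi.single j 1)).2).re
      map_add' := by
        intro q q'
        funext j
        simp only [Prod.fst_add, Prod.snd_add, Pi.add_apply, add_mul, Complex.add_re]
        ring
      map_smul' := by
        intro c q
        funext j
        simp only [Prod.smul_fst, Prod.smul_snd, Pi.smul_apply, smul_eq_mul, RingHom.id_apply,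
          Complex.real_smul, mul_assoc, Complex.re_ofReal_mul]
        ring }
  have hpair : ∀ q v, Λ q ⬝ᵥ v = q.1 * (Φ v).1 + (q.2 * (Φ v).2).re := by
    intro q v
    have hv : v = ∑ j, v j • (Pi.single j 1 : Fin 3 → ℝ) := by
      funext i
      simp [Finset.sum_apply, Pi.single_apply]
    have e : Φ v = ∑ j, v j • Φ (Pi.single j 1) := by
      conv_lhs => rw [hv]
      simp
    rw [e]
    simp only [dotProduct, Fin.sum_univ_three, Λ, LinearMap.coe_mk, AddHom.coe_mk, Prod.fst_add,
      Prod.snd_add, Prod.smul_fst, Prod.smul_snd, smul_eq_mul, Complex.real_smul, Complex.add_re,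
      Complex.mul_re, Complex.mul_im, Complex.add_im, Complex.ofReal_re, Complex.ofReal_im]
    ring
  have hinj : Function.Injective Λ := by
    rw [injective_iff_map_eq_zero]
    intro q hq
    have h : ∀ y : ℝ × ℂ, q.1 * y.1 + (q.2 * y.2).re = 0 := by
      intro y
      have := hpair q (Φ.symm y)
      rw [hq] at this
      simpa using this.symm
    have h1 := h (1, 0)
    have h2 := h (0, 1)
    have h3 := h (0, Complex.I)
    simp at h1 h2 h3
    exact Prod.ext h1 (Complex.ext h2 h3)
  have hfin : Module.finrank ℝ (ℝ × ℂ) = Module.finrank ℝ (Fin 3 → ℝ) := by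
    simp [Complex.finrank_real_complex]
  let Ψ := (LinearEquiv.ofInjectiveOfFinrankEq Λ hinj hfin).toContinuousLinearEquiv
  exact
    { vec := Φ
      covec := Ψ.symm
      pairing := by
        intro f v
        rw [← hpair]
        congr 1
        exact (Ψ.apply_symm_apply f).symm
      vec_mulVec := hΦ }

variable {w : SL3R} {l : ℝ} {μ : ℂ} (C : SpiralCoords w l μ)

theorem vec_pow_mulVec (n : ℕ) (v : Fin 3 → ℝ) :
    C.vec (((w ^ n : SL3R) : Mat3) *ᵥ v) = (l ^ n * (C.vec v).1, μ ^ n * (C.vec v).2) := by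
  induction n with
  | zero => simp
  | succ n ih =>
    rw [pow_succ', Matrix.SpecialLinearGroup.coe_mul, ← mulVec_mulVec, C.vec_mulVec, ih]
    simp only [pow_succ']
    ext <;> simp [mul_assoc]

theorem vec_pow_inv_mulVec (hl : l ≠ 0) (hμ : μ ≠ 0) (n : ℕ) (v : Fin 3 → ℝ) :
    C.vec ((((w ^ n)⁻¹ : SL3R) : Mat3) *ᵥ v) = (l⁻¹ ^ n * (C.vec v).1, μ⁻¹ ^ n * (C.vec v).2) := by
  have h := C.vec_pow_mulVec n ((((w ^ n)⁻¹ : SL3R) : Mat3) *ᵥ v)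
  rw [mulVec_mulVec, ← Matrix.SpecialLinearGroup.coe_mul, mul_inv_cancel] at h
  simp only [Matrix.SpecialLinearGroup.coe_one, one_mulVec] at h
  rw [h]
  have h1 : l⁻¹ ^ n * l ^ n = 1 := by rw [← mul_pow, inv_mul_cancel₀ hl, one_pow]
  have h2 : μ⁻¹ ^ n * μ ^ n = 1 := by rw [← mul_pow, inv_mul_cancel₀ hμ, one_pow]
  ext1
  · simp only [← mul_assoc, h1, one_mul]
  · simp only [← mul_assoc, h2, one_mul]

/-- Nondegeneracy of the pairing: testing against (1, 0), (0, 1) and (0, i) recovers all real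
coordinates. -/
theorem covec_eq_of_pairing {f : Fin 3 → ℝ} {q : ℝ × ℂ}
    (h : ∀ v, f ⬝ᵥ v = q.1 * (C.vec v).1 + (q.2 * (C.vec v).2).re) : C.covec f = q := by
  have h' : ∀ y : ℝ × ℂ, (C.covec f).1 * y.1 + ((C.covec f).2 * y.2).re =
      q.1 * y.1 + (q.2 * y.2).re := by
    intro y
    have := (C.pairing f (C.vec.symm y)).symm.trans (h _)
    simpa using this
  have h1 := h' (1, 0)
  have h2 := h' (0, 1)
  have h3 := h' (0, Complex.I)
  simp at h1 h2 h3
  exact Prod.ext h1 (Complex.ext h2 h3)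

/-- The pairing on the complex factor is Re(κz), with no conjugation, so the contragredient of
multiplication by μ is multiplication by μ⁻¹ and not by its conjugate. -/
theorem covec_vecMul_pow_inv (hl : l ≠ 0) (hμ : μ ≠ 0) (n : ℕ) (f : Fin 3 → ℝ) :
    C.covec (f ᵥ* (((w ^ n)⁻¹ : SL3R) : Mat3)) = (l⁻¹ ^ n * (C.covec f).1, μ⁻¹ ^ n * (C.covec f).2) := by
  apply C.covec_eq_of_pairing
  intro v
  rw [← dotProduct_mulVec, C.pairing, C.vec_pow_inv_mulVec hl hμ]
  ring_nf

/-- The real eigenvector. -/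
noncomputable def axis : Fin 3 → ℝ := C.vec.symm (1, 0)

theorem vec_axis : C.vec C.axis = (1, 0) := C.vec.apply_symm_apply _

theorem axis_ne_zero : C.axis ≠ 0 := by
  intro h
  have := C.vec_axis
  rw [h, map_zero] at this
  exact zero_ne_one (congrArg Prod.fst this)

end SpiralCoords

/-! ### Dynamics on lines and flags. -/

/-- A closed set of pairs (vector, covector) which is stable under scaling and under `Γ`. -/
structure IsInvariantCone (Γ : Subgroup SL3R) (S : Set ((Fin 3 → ℝ) × (Fin 3 → ℝ))) : Prop where
  isClosed : IsClosed S
  smul_mem : ∀ (c d : ℝ) {v f}, (v, f) ∈ S → (c • v, d • f) ∈ S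
  act_mem : ∀ γ ∈ Γ, ∀ {v f}, (v, f) ∈ S → ((γ : Mat3) *ᵥ v, f ᵥ* ((γ⁻¹ : SL3R) : Mat3)) ∈ S

theorem tendsto_of_equiv_tendsto {V W : Type*} [NormedAddCommGroup V] [NormedSpace ℝ V]
    [NormedAddCommGroup W] [NormedSpace ℝ W] (e : V ≃L[ℝ] W) {x : ℕ → V} {y : V}
    (h : Tendsto (fun k => e (x k)) atTop (𝓝 (e y))) : Tendsto x atTop (𝓝 y) := by
  have := (e.symm.continuous.tendsto (e y)).comp h
  simpa [Function.comp_def] using this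

/-- Rescaled negative powers of `μ` accumulate at every complex number, while the corresponding
multiples of the powers of `l⁻¹` vanish in the limit. -/
theorem exists_spiral_seq {l : ℝ} {μ : ℂ} (hμ0 : μ ≠ 0) (hlμ : ‖μ‖ < l)
    (hrot : ∀ k : ℕ, 0 < k → (μ ^ k).im ≠ 0) {z : ℂ} (hz : z ≠ 0) (z' : ℂ) :
    ∃ (φ : ℕ → ℕ) (d : ℝ), Tendsto φ atTop atTop ∧ (‖z‖ = ‖z'‖ → d = 1) ∧
      Tendsto (fun k => ((d * ‖μ‖ ^ φ k : ℝ) : ℂ) * (μ⁻¹ ^ φ k * z)) atTop (𝓝 z') ∧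
      Tendsto (fun k => (d * ‖μ‖ ^ φ k) * l⁻¹ ^ φ k) atTop (𝓝 0) := by
  have hn : 0 < ‖μ‖ := norm_pos_iff.2 hμ0
  have hl : 0 < l := hn.trans hlμ
  have hnz : ‖z‖ ≠ 0 := norm_ne_zero_iff.2 hz
  set u : ℂ := (‖μ‖ : ℂ) * μ⁻¹ with hu
  have hu1 : ‖u‖ = 1 := by
    rw [hu, norm_mul, norm_inv, Complex.norm_real, norm_norm, mul_inv_cancel₀ hn.ne']
  have huinf : ∀ k : ℕ, 0 < k → u ^ k ≠ 1 := by
    intro k hk h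
    apply hrot k hk
    rw [hu, mul_pow, inv_pow, mul_inv_eq_one₀ (pow_ne_zero k hμ0)] at h
    rw [← h, ← Complex.ofReal_pow, Complex.ofReal_im]
  -- Rotation by `u` preserves the modulus, so the scalar d = ‖z'‖/‖z‖ first moves z to the circle
  -- of z'.
  have hnorm : ‖((‖z'‖ / ‖z‖ : ℝ) : ℂ) * z‖ = ‖z'‖ := by
    rw [norm_mul, Complex.norm_real, norm_div, norm_norm, norm_norm, div_mul_cancel₀ _ hnz]
  obtain ⟨φ, hφ, hlim⟩ := exists_tendsto_pow_mul hu1 huinf hnorm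
  refine ⟨φ, ‖z'‖ / ‖z‖, hφ, ?_, ?_, ?_⟩
  · intro h
    rw [← h, div_self hnz]
  · refine hlim.congr fun k => ?_
    rw [hu, mul_pow]
    push_cast
    ring
  · have h0 : Tendsto (fun n : ℕ => (‖μ‖ * l⁻¹) ^ n) atTop (𝓝 0) := by
      apply tendsto_pow_atTop_nhds_zero_of_lt_one (by positivity)
      rwa [← div_eq_mul_inv, div_lt_one hl]
    have h1 := (h0.comp hφ).const_mul (‖z'‖ / ‖z‖)
    rw [mul_zero] at h1
    refine h1.congr fun k => ?_
    simp only [Function.comp_apply, mul_pow]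
    ring

section Dynamics

variable {Γ : Subgroup SL3R} {w : SL3R} {l : ℝ} {μ : ℂ}

/-- A closed invariant cone which contains a flag in general position with respect to `w` contains
all the flags through the real eigenline of `w`. -/
theorem IsInvariantCone.axis_mem {S : Set ((Fin 3 → ℝ) × (Fin 3 → ℝ))}
    (hS : IsInvariantCone Γ S) (C : SpiralCoords w l μ) (hw : w ∈ Γ) (hμ0 : μ ≠ 0)
    (hlμ : ‖μ‖ < l) (hrot : ∀ k : ℕ, 0 < k → (μ ^ k).im ≠ 0) {v f : Fin 3 → ℝ}
    (hvf : (v, f) ∈ S) (hv : (C.vec v).1 ≠ 0) (hf : (C.covec f).2 ≠ 0) {h : Fin 3 → ℝ}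
    (hh : h ⬝ᵥ C.axis = 0) : (C.axis, h) ∈ S := by
  have hn : 0 < ‖μ‖ := norm_pos_iff.2 hμ0
  have hl : 0 < l := hn.trans hlμ
  have hh1 : (C.covec h).1 = 0 := by
    rw [C.pairing, C.vec_axis] at hh
    simpa using hh
  obtain ⟨φ, d, hφ, -, hlim, hlim0⟩ := exists_spiral_seq hμ0 hlμ hrot hf (C.covec h).2
  -- Rescaled by l⁻ⁿ, the vector wⁿv tends to the axis since |μ| < l. Rescaled by |μ|ⁿ, the covector
  -- fw⁻ⁿ loses its real coordinate while its complex one rotates; the exponents are chosen so that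
  -- it tends to that of h.
  refine hS.isClosed.mem_of_tendsto (f := fun k =>
    (((C.vec v).1⁻¹ * l⁻¹ ^ φ k) • (((w ^ φ k : SL3R) : Mat3) *ᵥ v),
      (d * ‖μ‖ ^ φ k) • (f ᵥ* (((w ^ φ k)⁻¹ : SL3R) : Mat3)))) (b := atTop) ?_
    (Eventually.of_forall fun k => hS.smul_mem _ _ (hS.act_mem _ (Γ.pow_mem hw _) hvf))
  refine Tendsto.prodMk_nhds ?_ ?_
  · apply tendsto_of_equiv_tendsto C.vec
    simp only [map_smul, C.vec_pow_mulVec, C.vec_axis, Prod.smul_mk]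
    refine Tendsto.prodMk_nhds ?_ ?_
    · refine tendsto_const_nhds.congr fun k => ?_
      have : l⁻¹ ^ φ k * l ^ φ k = 1 := by rw [← mul_pow, inv_mul_cancel₀ hl.ne', one_pow]
      rw [smul_eq_mul]
      calc (1 : ℝ) = ((C.vec v).1⁻¹ * (C.vec v).1) * (l⁻¹ ^ φ k * l ^ φ k) := by
            rw [this, inv_mul_cancel₀ hv, one_mul]
        _ = _ := by ring
    · have h0 : Tendsto (fun n : ℕ => ((l⁻¹ : ℝ) * μ : ℂ) ^ n) atTop (𝓝 0) := by
        apply tendsto_pow_atTop_nhds_zero_of_norm_lt_one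
        rw [norm_mul, Complex.norm_real, norm_inv, Real.norm_of_nonneg hl.le, inv_mul_eq_div,
          div_lt_one hl]
        exact hlμ
      have h1 := (h0.comp hφ).const_mul (((C.vec v).1⁻¹ : ℝ) * (C.vec v).2 : ℂ)
      rw [mul_zero] at h1
      refine h1.congr fun k => ?_
      rw [Complex.real_smul, Function.comp_apply, mul_pow]
      push_cast
      ring
  · apply tendsto_of_equiv_tendsto C.covec
    simp only [map_smul, C.covec_vecMul_pow_inv hl.ne' hμ0, Prod.smul_mk]
    refine Tendsto.prodMk_nhds ?_ ?_
    · have h1 := hlim0.mul_const (C.covec f).1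
      rw [zero_mul] at h1
      change Tendsto _ _ (𝓝 (C.covec h).1)
      rw [hh1]
      refine h1.congr fun k => ?_
      rw [smul_eq_mul]
      ring
    · refine hlim.congr fun k => ?_
      rw [Complex.real_smul]

/-- A closed `Γ`-invariant cone of vectors which contains the axis of `w` is everything. -/
theorem eq_univ_of_axis_mem (C : SpiralCoords w l μ) (hw : w ∈ Γ) (hμ0 : μ ≠ 0)
    (hlμ : ‖μ‖ < l) (hrot : ∀ k : ℕ, 0 < k → (μ ^ k).im ≠ 0)
    (hirr : ∀ x y : Fin 3 → ℝ, (∀ γ ∈ Γ, x ⬝ᵥ ((γ : Mat3) *ᵥ y) = 0) → x = 0 ∨ y = 0)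
    {D : Set (Fin 3 → ℝ)} (hD : IsClosed D) (hsmul : ∀ (c : ℝ) {v}, v ∈ D → c • v ∈ D)
    (hact : ∀ γ ∈ Γ, ∀ {v}, v ∈ D → (γ : Mat3) *ᵥ v ∈ D) (haxis : C.axis ∈ D) :
    D = Set.univ := by
  have hn : 0 < ‖μ‖ := norm_pos_iff.2 hμ0
  have hl : 0 < l := hn.trans hlμ
  have key : ∀ x y : Fin 3 → ℝ, x ≠ 0 → y ≠ 0 → ∃ γ ∈ Γ, x ⬝ᵥ ((γ : Mat3) *ᵥ y) ≠ 0 := by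
    intro x y hx hy
    by_contra! h
    exact (hirr x y h).elim hx hy
  have hne : ∀ (e : (Fin 3 → ℝ) ≃L[ℝ] ℝ × ℂ) (q : ℝ × ℂ), q ≠ 0 → e.symm q ≠ 0 := by
    intro e q hq
    simpa using hq
  -- the complex eigenplane is contained in `D`
  have hplane : ∀ v, (C.vec v).1 = 0 → v ∈ D := by
    intro v hv
    obtain ⟨γ, hγ, hγ0⟩ := key (C.covec.symm (0, 1)) C.axis (hne _ _ (by simp)) C.axis_ne_zero
    have hz : (C.vec ((γ : Mat3) *ᵥ C.axis)).2 ≠ 0 := by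
      intro h
      rw [C.pairing] at hγ0
      simp [h] at hγ0
    -- The translated axis has a nonzero complex coordinate. Under rescaled w⁻ⁿ its real coordinate
    -- dies, and the complex one accumulates at the prescribed point of the plane.
    obtain ⟨φ, d, hφ, -, hlim, hlim0⟩ := exists_spiral_seq hμ0 hlμ hrot hz (C.vec v).2
    refine hD.mem_of_tendsto (f := fun k => (d * ‖μ‖ ^ φ k) •
      ((((w ^ φ k)⁻¹ : SL3R) : Mat3) *ᵥ ((γ : Mat3) *ᵥ C.axis))) (b := atTop) ?_
      (Eventually.of_forall fun k =>
        hsmul _ (hact _ (Γ.inv_mem (Γ.pow_mem hw _)) (hact γ hγ haxis)))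
    apply tendsto_of_equiv_tendsto C.vec
    simp only [map_smul, C.vec_pow_inv_mulVec hl.ne' hμ0, Prod.smul_mk]
    refine Tendsto.prodMk_nhds ?_ ?_
    · have h1 := hlim0.mul_const (C.vec ((γ : Mat3) *ᵥ C.axis)).1
      rw [zero_mul] at h1
      change Tendsto _ _ (𝓝 (C.vec v).1)
      rw [hv]
      refine h1.congr fun k => ?_
      rw [smul_eq_mul]
      ring
    · refine hlim.congr fun k => ?_
      rw [Complex.real_smul]
  -- a translate of the complex eigenplane by an element of `Γ`
  obtain ⟨γ, hγ, hγ0⟩ := key (C.covec.symm (1, 0)) (C.vec.symm (0, 1)) (hne _ _ (by simp))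
    (hne _ _ (by simp))
  set h : Fin 3 → ℝ := C.covec.symm (1, 0) ᵥ* (γ : Mat3) with hh
  have hhD : ∀ v, h ⬝ᵥ v = 0 → v ∈ D := by
    intro v hv
    rw [hh, ← dotProduct_mulVec, C.pairing] at hv
    have h1 : (γ : Mat3) *ᵥ v ∈ D := hplane _ (by simpa using hv)
    have h2 := hact _ (Γ.inv_mem hγ) h1
    rwa [mulVec_mulVec, ← Matrix.SpecialLinearGroup.coe_mul, inv_mul_cancel,
      Matrix.SpecialLinearGroup.coe_one, one_mulVec] at h2
  have hκ : (C.covec h).2 ≠ 0 := by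
    intro h0
    rw [dotProduct_mulVec, ← hh, C.pairing, h0] at hγ0
    simp at hγ0
  set β := (C.covec h).1
  set κ := (C.covec h).2
  -- The equation of wⁿ(ker h). After rescaling by |μ|ⁿ the real coefficient tends to 0, so these
  -- planes nearly contain the axis and turn around it.
  have hhwD : ∀ (n : ℕ) v, β * (l⁻¹ ^ n * (C.vec v).1) + (κ * (μ⁻¹ ^ n * (C.vec v).2)).re = 0 →
      v ∈ D := by
    intro n v hv
    have h1 : (((w ^ n)⁻¹ : SL3R) : Mat3) *ᵥ v ∈ D := by
      apply hhD
      rw [C.pairing, C.vec_pow_inv_mulVec hl.ne' hμ0]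
      exact hv
    have h2 := hact _ (Γ.pow_mem hw n) h1
    rwa [mulVec_mulVec, ← Matrix.SpecialLinearGroup.coe_mul, mul_inv_cancel,
      Matrix.SpecialLinearGroup.coe_one, one_mulVec] at h2
  rw [Set.eq_univ_iff_forall]
  intro v
  by_cases hz : (C.vec v).2 = 0
  · have hvax : v = (C.vec v).1 • C.axis := by
      apply C.vec.injective
      rw [map_smul, C.vec_axis]
      ext1
      · simp
      · simp [hz]
    rw [hvax]
    exact hsmul _ haxis
  set α := (C.vec v).1
  set z := (C.vec v).2
  -- The target is purely imaginary, so the real part, which measures how far v is from the turning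
  -- plane, tends to 0. Its modulus equals that of κz, which makes d = 1.
  obtain ⟨φ, d, hφ, hd, hlim, hlim0⟩ := exists_spiral_seq hμ0 hlμ hrot (mul_ne_zero hκ hz)
    (Complex.I * (‖κ * z‖ : ℝ))
  obtain rfl : d = 1 := hd (by simp)
  simp only [one_mul] at hlim hlim0
  set ε : ℕ → ℝ := fun k => ‖μ‖ ^ φ k * l⁻¹ ^ φ k * (β * α) +
    (((‖μ‖ ^ φ k : ℝ) : ℂ) * (μ⁻¹ ^ φ k * (κ * z))).re with hε
  have hε0 : Tendsto ε atTop (𝓝 0) := by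
    have h1 := hlim0.mul_const (β * α)
    have h2 := (Complex.continuous_re.tendsto _).comp hlim
    have h3 := h1.add h2
    have e : (0 : ℝ) * (β * α) + (Complex.I * (‖κ * z‖ : ℝ)).re = 0 := by
      rw [zero_mul, zero_add, Complex.I_mul_re, Complex.ofReal_im, neg_zero]
    rw [e] at h3
    exact h3
  set c : ℕ → ℂ := fun k => ((‖μ‖ ^ φ k : ℝ) : ℂ) * (μ⁻¹ ^ φ k * κ) with hc
  have hcn : ∀ k, ‖c k‖ = ‖κ‖ := by
    intro k
    simp only [hc]
    rw [norm_mul, norm_mul, Complex.norm_real, norm_pow, norm_pow, norm_norm, norm_inv, ← mul_assoc,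
      ← mul_pow, mul_inv_cancel₀ hn.ne', one_pow, one_mul]
  have hc0 : ∀ k, c k ≠ 0 := fun k => norm_ne_zero_iff.1 (by rw [hcn]; exact norm_ne_zero_iff.2 hκ)
  -- Subtracting ε/c from the complex coordinate lands exactly on the plane, since |c| = |κ| stays
  -- fixed, and the correction vanishes in the limit.
  refine hD.mem_of_tendsto (f := fun k => C.vec.symm (α, z - ε k * (c k)⁻¹)) (b := atTop) ?_
    (Eventually.of_forall fun k => hhwD (φ k) _ ?_)
  · apply tendsto_of_equiv_tendsto C.vec
    simp only [ContinuousLinearEquiv.apply_symm_apply]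
    refine Tendsto.prodMk_nhds tendsto_const_nhds ?_
    have h1 : Tendsto (fun k => (ε k : ℂ) * (c k)⁻¹) atTop (𝓝 0) := by
      rw [tendsto_zero_iff_norm_tendsto_zero]
      have h2 := (hε0.norm).mul_const (‖κ‖⁻¹)
      rw [norm_zero, zero_mul] at h2
      refine h2.congr fun k => ?_
      rw [norm_mul, norm_inv, hcn, Complex.norm_real]
    simpa using (tendsto_const_nhds (x := z)).sub h1
  · simp only [ContinuousLinearEquiv.apply_symm_apply]
    have hpos : ‖μ‖ ^ φ k ≠ 0 := pow_ne_zero _ hn.ne'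
    apply mul_left_cancel₀ hpos
    rw [mul_zero, mul_add, ← Complex.re_ofReal_mul]
    have h1 : ((‖μ‖ ^ φ k : ℝ) : ℂ) * (κ * (μ⁻¹ ^ φ k * (z - ε k * (c k)⁻¹))) =
        ((‖μ‖ ^ φ k : ℝ) : ℂ) * (μ⁻¹ ^ φ k * (κ * z)) - ε k * (c k * (c k)⁻¹) := by
      simp only [hc]
      ring
    rw [h1, mul_inv_cancel₀ (hc0 k), mul_one, Complex.sub_re, Complex.ofReal_re]
    simp only [hε]
    ring

/-- A closed invariant cone which contains a flag contains all flags. -/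
theorem IsInvariantCone.flag_mem {S : Set ((Fin 3 → ℝ) × (Fin 3 → ℝ))}
    (hS : IsInvariantCone Γ S) (C : SpiralCoords w l μ) (hw : w ∈ Γ) (hμ0 : μ ≠ 0)
    (hlμ : ‖μ‖ < l) (hrot : ∀ k : ℕ, 0 < k → (μ ^ k).im ≠ 0)
    (hirr : ∀ x y : Fin 3 → ℝ, (∀ γ ∈ Γ, x ⬝ᵥ ((γ : Mat3) *ᵥ y) = 0) → x = 0 ∨ y = 0)
    {v₀ f₀ : Fin 3 → ℝ} (h₀ : (v₀, f₀) ∈ S) (hv₀ : v₀ ≠ 0) (hf₀ : f₀ ≠ 0) (hfv₀ : f₀ ⬝ᵥ v₀ = 0)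
    {v f : Fin 3 → ℝ} (hv : v ≠ 0) (hfv : f ⬝ᵥ v = 0) : (v, f) ∈ S := by
  -- move the given flag to general position
  have hbase : ∀ h, h ⬝ᵥ C.axis = 0 → (C.axis, h) ∈ S := by
    intro h hh
    obtain ⟨γ, hγ, hγ0⟩ : ∃ γ ∈ Γ, C.covec.symm (1, 0) ⬝ᵥ ((γ : Mat3) *ᵥ v₀) ≠ 0 := by
      by_contra! H
      rcases hirr _ _ H with h1 | h1
      · have := congrArg C.covec h1
        rw [C.covec.apply_symm_apply, map_zero] at this
        exact one_ne_zero (congrArg Prod.fst this)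
      · exact hv₀ h1
    have hα : (C.vec ((γ : Mat3) *ᵥ v₀)).1 ≠ 0 := by
      rw [C.pairing] at hγ0
      simpa using hγ0
    refine hS.axis_mem C hw hμ0 hlμ hrot (hS.act_mem γ hγ h₀) hα ?_ hh
    -- Were the complex part of the covector zero, annihilating a vector with nonzero real
    -- coordinate would make its real part zero too. One choice of γ thus puts both line and plane
    -- in general position.
    intro h2
    have hpair : (f₀ ᵥ* ((γ⁻¹ : SL3R) : Mat3)) ⬝ᵥ ((γ : Mat3) *ᵥ v₀) = 0 := by
      rw [← dotProduct_mulVec, mulVec_mulVec, ← Matrix.SpecialLinearGroup.coe_mul, inv_mul_cancel,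
        Matrix.SpecialLinearGroup.coe_one, one_mulVec, hfv₀]
    rw [C.pairing, h2] at hpair
    have h1 : (C.covec (f₀ ᵥ* ((γ⁻¹ : SL3R) : Mat3))).1 = 0 := by
      simpa [hα] using hpair
    have h3 : f₀ ᵥ* ((γ⁻¹ : SL3R) : Mat3) = 0 := by
      apply C.covec.injective
      rw [map_zero]
      exact Prod.ext h1 h2
    apply hf₀
    have h4 := congrArg (· ᵥ* (γ : Mat3)) h3
    simpa only [vecMul_vecMul, ← Matrix.SpecialLinearGroup.coe_mul, inv_mul_cancel,
      Matrix.SpecialLinearGroup.coe_one, vecMul_one, zero_vecMul] using h4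
  have hgood : ∀ γ ∈ Γ, ∀ h, h ⬝ᵥ ((γ : Mat3) *ᵥ C.axis) = 0 →
      ((γ : Mat3) *ᵥ C.axis, h) ∈ S := by
    intro γ hγ h hh
    rw [dotProduct_mulVec] at hh
    have h1 := hS.act_mem γ hγ (hbase _ hh)
    rwa [vecMul_vecMul, ← Matrix.SpecialLinearGroup.coe_mul, mul_inv_cancel,
      Matrix.SpecialLinearGroup.coe_one, vecMul_one] at h1
  have huniv := eq_univ_of_axis_mem C hw hμ0 hlμ hrot hirr
    (D := closure {x | ∃ c : ℝ, ∃ γ ∈ Γ, x = c • ((γ : Mat3) *ᵥ C.axis)}) isClosed_closure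
    (by
      intro c x hx
      refine map_mem_closure (f := fun x : Fin 3 → ℝ => c • x) (by fun_prop) hx ?_
      rintro _ ⟨c', γ, hγ, rfl⟩
      exact ⟨c * c', γ, hγ, by simp only [smul_smul]⟩)
    (by
      intro γ hγ x hx
      refine map_mem_closure (f := fun x : Fin 3 → ℝ => (γ : Mat3) *ᵥ x) (by fun_prop) hx ?_
      rintro _ ⟨c', γ', hγ', rfl⟩
      exact ⟨c', γ * γ', Γ.mul_mem hγ hγ', by
        simp only [mulVec_smul, mulVec_mulVec, Matrix.SpecialLinearGroup.coe_mul]⟩)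
    (subset_closure ⟨1, 1, Γ.one_mem, by simp⟩)
  have hvc : v ∈ closure {x | ∃ c : ℝ, ∃ γ ∈ Γ, x = c • ((γ : Mat3) *ᵥ C.axis)} := by
    rw [huniv]; trivial
  have hvv : v ⬝ᵥ v ≠ 0 := by
    rwa [Ne, dotProduct_self_eq_zero]
  -- push the covector along
  set σ : (Fin 3 → ℝ) → (Fin 3 → ℝ) × (Fin 3 → ℝ) :=
    fun x => (x, (x ⬝ᵥ x) • f - (f ⬝ᵥ x) • x) with hσ
  -- `σ` attaches to each x, continuously, a covector annihilating x, and `σ v` is (v, (v·v)f)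
  -- because f·v = 0. Density of the translated axes among vectors therefore suffices. The covector
  -- is quadratic in x, hence the factor c².
  have hmem : σ v ∈ closure S := by
    refine map_mem_closure (f := σ) (by simp only [hσ]; fun_prop) hvc ?_
    rintro _ ⟨c, γ, hγ, rfl⟩
    set x := (γ : Mat3) *ᵥ C.axis with hx
    have h1 := hS.smul_mem c (c ^ 2) (hgood γ hγ ((x ⬝ᵥ x) • f - (f ⬝ᵥ x) • x) (by
      simp only [← hx, sub_dotProduct, smul_dotProduct, smul_eq_mul]
      ring))
    convert h1 using 2
    simp only [dotProduct_smul, smul_dotProduct, smul_sub, smul_smul, smul_eq_mul]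
    congr 2 <;> ring
  rw [hS.isClosed.closure_eq] at hmem
  have h1 := hS.smul_mem 1 (v ⬝ᵥ v)⁻¹ hmem
  simpa [hσ, hfv, smul_smul, hvv] using h1

end Dynamics

/-! ### From pairs (vector, covector) to G/P. -/

theorem mulVec_single_one_eq_col (g : Mat3) (j : Fin 3) :
    g *ᵥ Pi.single j 1 = fun i => g i j := by
  funext i
  simp

/-- Matrices with prescribed first column `v`, whose second column is the projection of `u` to the
kernel of `f` along `z`, and whose last column is a multiple of `z`. -/
noncomputable def flagSection (u z : Fin 3 → ℝ) (q : (Fin 3 → ℝ) × (Fin 3 → ℝ)) : Mat3 :=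
  Matrix.of fun i => ![q.1 i, u i - (q.2 ⬝ᵥ u) / (q.2 ⬝ᵥ z) * z i,
    z i / (Matrix.of fun i => ![q.1 i, u i - (q.2 ⬝ᵥ u) / (q.2 ⬝ᵥ z) * z i, z i] : Mat3).det]

theorem det_flagSection {u z : Fin 3 → ℝ} {q : (Fin 3 → ℝ) × (Fin 3 → ℝ)}
    (h : (Matrix.of fun i => ![q.1 i, u i - (q.2 ⬝ᵥ u) / (q.2 ⬝ᵥ z) * z i, z i] : Mat3).det ≠ 0) :
    (flagSection u z q).det = 1 := by
  rw [flagSection]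
  generalize hD : (Matrix.of fun i => ![q.1 i, u i - (q.2 ⬝ᵥ u) / (q.2 ⬝ᵥ z) * z i, z i] :
    Mat3).det = D at h ⊢
  rw [← div_self h]
  nth_rewrite 2 [← hD]
  simp only [det_fin_three, of_apply, cons_val]
  field_simp

/-- Two elements of `SL(3, ℝ)` define the same flag if they give the same line and plane. -/
theorem mk_eq_mk_of_flag {g h : SL3R} {c d : ℝ}
    (hc : (h : Mat3) *ᵥ Pi.single 0 1 = c • ((g : Mat3) *ᵥ Pi.single 0 1))
    (hd : Pi.single 2 1 ᵥ* ((g⁻¹ : SL3R) : Mat3) = d • (Pi.single 2 1 ᵥ* ((h⁻¹ : SL3R) : Mat3))) :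
    (g : FurstenbergBoundary) = h := by
  rw [QuotientGroup.eq]
  have h1 : ((g⁻¹ * h : SL3R) : Mat3) *ᵥ Pi.single 0 1 = c • Pi.single 0 1 := by
    rw [Matrix.SpecialLinearGroup.coe_mul, ← mulVec_mulVec, hc, mulVec_smul, mulVec_mulVec,
      ← Matrix.SpecialLinearGroup.coe_mul, inv_mul_cancel, Matrix.SpecialLinearGroup.coe_one,
      one_mulVec]
  have h2 : Pi.single 2 1 ᵥ* ((g⁻¹ * h : SL3R) : Mat3) = d • Pi.single 2 1 := by
    rw [Matrix.SpecialLinearGroup.coe_mul, ← vecMul_vecMul, hd, smul_vecMul, vecMul_vecMul,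
      ← Matrix.SpecialLinearGroup.coe_mul, inv_mul_cancel, Matrix.SpecialLinearGroup.coe_one,
      vecMul_one]
  have e1 : ∀ i, ((g⁻¹ * h : SL3R) : Mat3) i 0 = c * (Pi.single 0 1 : Fin 3 → ℝ) i := by
    intro i
    have := congrFun h1 i
    rwa [mulVec_single_one_eq_col] at this
  have e2 : ∀ j, ((g⁻¹ * h : SL3R) : Mat3) 2 j = d * (Pi.single 2 1 : Fin 3 → ℝ) j := by
    intro j
    have := congrFun h2 j
    rwa [single_one_vecMul] at this
  intro i j hij
  -- Every entry below the diagonal lies in the first column or the last row.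
  have hcases : j = 0 ∧ i ≠ 0 ∨ i = 2 ∧ j ≠ 2 := by
    revert i j
    decide
  rcases hcases with ⟨rfl, hi⟩ | ⟨rfl, hj⟩
  · rw [e1, Pi.single_eq_of_ne hi, mul_zero]
  · rw [e2, Pi.single_eq_of_ne hj, mul_zero]

/-- Continuity of the determinant is included because nearby pairs must keep it nonzero for the
section to land in SL(3, ℝ). -/
theorem continuousAt_flagSection {u z : Fin 3 → ℝ} {q : (Fin 3 → ℝ) × (Fin 3 → ℝ)}
    (hz : q.2 ⬝ᵥ z ≠ 0)
    (h : (Matrix.of fun i => ![q.1 i, u i - (q.2 ⬝ᵥ u) / (q.2 ⬝ᵥ z) * z i, z i] : Mat3).det ≠ 0) :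
    ContinuousAt (fun q : (Fin 3 → ℝ) × (Fin 3 → ℝ) =>
      (Matrix.of fun i => ![q.1 i, u i - (q.2 ⬝ᵥ u) / (q.2 ⬝ᵥ z) * z i, z i] : Mat3).det) q ∧
    ContinuousAt (flagSection u z) q := by
  have hu : Continuous fun q : (Fin 3 → ℝ) × (Fin 3 → ℝ) => q.2 ⬝ᵥ u := by fun_prop
  have hzc : Continuous fun q : (Fin 3 → ℝ) × (Fin 3 → ℝ) => q.2 ⬝ᵥ z := by fun_prop
  have h2 : ∀ i, ContinuousAt (fun q : (Fin 3 → ℝ) × (Fin 3 → ℝ) =>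
      u i - (q.2 ⬝ᵥ u) / (q.2 ⬝ᵥ z) * z i) q := fun i =>
    continuousAt_const.sub ((hu.continuousAt.div hzc.continuousAt hz).mul continuousAt_const)
  have h1 : ∀ i, ContinuousAt (fun q : (Fin 3 → ℝ) × (Fin 3 → ℝ) => q.1 i) q := fun i => by
    fun_prop
  have hdet : ContinuousAt (fun q : (Fin 3 → ℝ) × (Fin 3 → ℝ) =>
      (Matrix.of fun i => ![q.1 i, u i - (q.2 ⬝ᵥ u) / (q.2 ⬝ᵥ z) * z i, z i] : Mat3).det) q := by
    have hM : ContinuousAt (fun q : (Fin 3 → ℝ) × (Fin 3 → ℝ) =>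
        (Matrix.of fun i => ![q.1 i, u i - (q.2 ⬝ᵥ u) / (q.2 ⬝ᵥ z) * z i, z i] : Mat3)) q := by
      refine continuousAt_pi.2 fun i => continuousAt_pi.2 fun j => ?_
      fin_cases j
      · exact h1 i
      · exact h2 i
      · exact continuousAt_const
    exact (continuous_id.matrix_det.continuousAt).comp hM
  refine ⟨hdet, continuousAt_pi.2 fun i => continuousAt_pi.2 fun j => ?_⟩
  fin_cases j
  · exact h1 i
  · exact h2 i
  · exact continuousAt_const.div hdet h

/-- If every closed invariant cone containing a flag contains all flags, then the action on the
Furstenberg boundary is minimal. -/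
theorem isMinimal_of_flag_mem {Γ : Subgroup SL3R}
    (H : ∀ {S : Set ((Fin 3 → ℝ) × (Fin 3 → ℝ))}, IsInvariantCone Γ S → ∀ {v₀ f₀ : Fin 3 → ℝ},
      (v₀, f₀) ∈ S → v₀ ≠ 0 → f₀ ≠ 0 → f₀ ⬝ᵥ v₀ = 0 → ∀ {v f : Fin 3 → ℝ}, v ≠ 0 →
      f ⬝ᵥ v = 0 → (v, f) ∈ S) :
    MulAction.IsMinimal Γ FurstenbergBoundary := by
  have hvne : ∀ g : SL3R, (g : Mat3) *ᵥ Pi.single 0 1 ≠ 0 := by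
    intro g h
    have := congrArg (((g⁻¹ : SL3R) : Mat3) *ᵥ ·) h
    simp only [mulVec_mulVec, ← Matrix.SpecialLinearGroup.coe_mul, inv_mul_cancel,
      Matrix.SpecialLinearGroup.coe_one, one_mulVec, mulVec_zero] at this
    simpa using congrFun this 0
  have hfne : ∀ g : SL3R, Pi.single 2 1 ᵥ* ((g⁻¹ : SL3R) : Mat3) ≠ 0 := by
    intro g h
    have := congrArg (· ᵥ* (g : Mat3)) h
    simp only [vecMul_vecMul, ← Matrix.SpecialLinearGroup.coe_mul, inv_mul_cancel,
      Matrix.SpecialLinearGroup.coe_one, vecMul_one, zero_vecMul] at this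
    simpa using congrFun this 2
  have hpair : ∀ (g : SL3R) (x : Fin 3 → ℝ),
      (Pi.single 2 1 ᵥ* ((g⁻¹ : SL3R) : Mat3)) ⬝ᵥ ((g : Mat3) *ᵥ x) = x 2 := by
    intro g x
    rw [← dotProduct_mulVec, mulVec_mulVec, ← Matrix.SpecialLinearGroup.coe_mul, inv_mul_cancel,
      Matrix.SpecialLinearGroup.coe_one, one_mulVec, single_one_dotProduct]
  constructor
  intro x y
  induction x using QuotientGroup.induction_on with | _ g₀ => ?_
  induction y using QuotientGroup.induction_on with | _ g₁ => ?_
  set v₀ := (g₀ : Mat3) *ᵥ Pi.single 0 1 with hv₀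
  set f₀ := Pi.single 2 1 ᵥ* ((g₀⁻¹ : SL3R) : Mat3) with hf₀
  set O : Set ((Fin 3 → ℝ) × (Fin 3 → ℝ)) := {q | ∃ γ ∈ Γ, ∃ c d : ℝ,
    q = (c • ((γ : Mat3) *ᵥ v₀), d • (f₀ ᵥ* ((γ⁻¹ : SL3R) : Mat3)))} with hO
  have hcone : IsInvariantCone Γ (closure O) := by
    refine ⟨isClosed_closure, ?_, ?_⟩
    · intro c d v f hvf
      refine map_mem_closure (f := fun q : (Fin 3 → ℝ) × (Fin 3 → ℝ) => (c • q.1, d • q.2))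
        (by fun_prop) hvf ?_
      rintro _ ⟨γ, hγ, c', d', rfl⟩
      exact ⟨γ, hγ, c * c', d * d', by simp only [smul_smul]⟩
    · intro γ hγ v f hvf
      refine map_mem_closure (f := fun q : (Fin 3 → ℝ) × (Fin 3 → ℝ) =>
        ((γ : Mat3) *ᵥ q.1, q.2 ᵥ* ((γ⁻¹ : SL3R) : Mat3))) (by fun_prop) hvf ?_
      rintro _ ⟨γ', hγ', c', d', rfl⟩
      refine ⟨γ * γ', Γ.mul_mem hγ hγ', c', d', ?_⟩
      simp only [mulVec_smul, mulVec_mulVec, smul_vecMul, vecMul_vecMul, _root_.mul_inv_rev,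
        Matrix.SpecialLinearGroup.coe_mul]
  set q₁ : (Fin 3 → ℝ) × (Fin 3 → ℝ) :=
    ((g₁ : Mat3) *ᵥ Pi.single 0 1, Pi.single 2 1 ᵥ* ((g₁⁻¹ : SL3R) : Mat3)) with hq₁
  have hmem : q₁ ∈ closure O := by
    refine H hcone (v₀ := v₀) (f₀ := f₀) (subset_closure ⟨1, Γ.one_mem, 1, 1, by simp⟩) (hvne g₀)
      (hfne g₀) ?_ (hvne g₁) ?_
    · rw [hv₀, hf₀, hpair]; simp
    · rw [hpair]; simp
  -- Taking the other two columns of g₁ as `u` and `z` makes the section pass through g₁ itself.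
  set u : Fin 3 → ℝ := (g₁ : Mat3) *ᵥ Pi.single 1 1 with hu
  set z : Fin 3 → ℝ := (g₁ : Mat3) *ᵥ Pi.single 2 1 with hz
  have hqu : q₁.2 ⬝ᵥ u = 0 := by simp only [hq₁, hu]; rw [hpair]; simp
  have hqz : q₁.2 ⬝ᵥ z = 1 := by simp only [hq₁, hz]; rw [hpair]; simp
  have hbase : (Matrix.of fun i => ![q₁.1 i, u i - (q₁.2 ⬝ᵥ u) / (q₁.2 ⬝ᵥ z) * z i, z i] : Mat3) =
      g₁ := by
    rw [hqu, hqz]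
    ext i j
    simp only [hq₁, hu, hz, mulVec_single_one_eq_col]
    fin_cases j <;> simp
  have hbase' : flagSection u z q₁ = g₁ := by
    rw [flagSection, hbase, Matrix.SpecialLinearGroup.det_coe]
    simp only [div_one]
    exact hbase
  have hdet₁ : (Matrix.of fun i => ![q₁.1 i, u i - (q₁.2 ⬝ᵥ u) / (q₁.2 ⬝ᵥ z) * z i, z i] :
      Mat3).det ≠ 0 := by
    rw [hbase, Matrix.SpecialLinearGroup.det_coe]
    exact one_ne_zero
  obtain ⟨hcd, hcs⟩ := continuousAt_flagSection (by rw [hqz]; exact one_ne_zero) hdet₁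
  rw [mem_closure_iff]
  intro W hW hyW
  have hW' : IsOpen ((fun g : SL3R => (g : FurstenbergBoundary)) ⁻¹' W) :=
    hW.preimage continuous_quot_mk
  obtain ⟨W', hW'o, hW'e⟩ := isOpen_induced_iff.1 hW'
  have hg₁W : flagSection u z q₁ ∈ W' := by
    rw [hbase']
    have : g₁ ∈ (fun g : SL3R => (g : FurstenbergBoundary)) ⁻¹' W := hyW
    rw [← hW'e] at this
    exact this
  have hzc : ContinuousAt (fun q : (Fin 3 → ℝ) × (Fin 3 → ℝ) => q.2 ⬝ᵥ z) q₁ :=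
    Continuous.continuousAt (by fun_prop)
  have hev := (((hcs.eventually (hW'o.mem_nhds hg₁W)).and (hcd.eventually_ne hdet₁)).and
    (hzc.eventually_ne (by rw [hqz]; exact one_ne_zero)))
  -- A pair in the orbit cone itself, so close to q₁ that the section is defined there and lands in
  -- W; its value represents a translate of g₀P.
  obtain ⟨q, hqO, ⟨hqW, hqd⟩, hqz0⟩ := ((mem_closure_iff_frequently.1 hmem).and_eventually hev).exists
  obtain ⟨γ, hγ, c, d, rfl⟩ := hqO
  set q : (Fin 3 → ℝ) × (Fin 3 → ℝ) :=
    (c • ((γ : Mat3) *ᵥ v₀), d • (f₀ ᵥ* ((γ⁻¹ : SL3R) : Mat3))) with hq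
  set g : SL3R := ⟨flagSection u z q, det_flagSection hqd⟩ with hg
  have hgcoe : (g : Mat3) = flagSection u z q := rfl
  have hgW : (g : FurstenbergBoundary) ∈ W := by
    have : g ∈ (fun g : SL3R => (g : FurstenbergBoundary)) ⁻¹' W := by
      rw [← hW'e]; exact hqW
    exact this
  refine ⟨(g : FurstenbergBoundary), hgW, ⟨⟨γ, hγ⟩, ?_⟩⟩
  change ((γ * g₀ : SL3R) : FurstenbergBoundary) = g
  have hcol0 : (g : Mat3) *ᵥ Pi.single 0 1 = c • (((γ * g₀ : SL3R) : Mat3) *ᵥ Pi.single 0 1) := by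
    rw [mulVec_single_one_eq_col, hgcoe, Matrix.SpecialLinearGroup.coe_mul, ← mulVec_mulVec, ← hv₀]
    funext i
    simp [flagSection, hq]
  have hq0 : q.2 ⬝ᵥ q.1 = 0 := by
    have : f₀ ⬝ᵥ v₀ = 0 := by rw [hv₀, hf₀, hpair]; simp
    simp only [hq, dotProduct_smul, smul_dotProduct]
    rw [← dotProduct_mulVec, mulVec_mulVec, ← Matrix.SpecialLinearGroup.coe_mul, inv_mul_cancel,
      Matrix.SpecialLinearGroup.coe_one, one_mulVec, this]
    simp
  -- the covector of the flag is the last row of `g⁻¹`, up to a scalar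
  obtain ⟨t, ht⟩ : ∃ t : ℝ, q.2 ᵥ* (g : Mat3) = t • Pi.single 2 1 := by
    refine ⟨(q.2 ᵥ* (g : Mat3)) 2, ?_⟩
    funext j
    fin_cases j
    · have : (q.2 ᵥ* (g : Mat3)) 0 = q.2 ⬝ᵥ q.1 := by
        simp [vecMul, dotProduct, hgcoe, flagSection]
      simp [this, hq0]
    · have : (q.2 ᵥ* (g : Mat3)) 1 = q.2 ⬝ᵥ u - (q.2 ⬝ᵥ u) / (q.2 ⬝ᵥ z) * (q.2 ⬝ᵥ z) := by
        simp only [vecMul, dotProduct, hgcoe, flagSection, Fin.sum_univ_three, of_apply, cons_val]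
        ring
      rw [div_mul_cancel₀ _ hqz0, sub_self] at this
      simp [this]
    · simp
  have ht' : d • (Pi.single 2 1 ᵥ* (((γ * g₀)⁻¹ : SL3R) : Mat3)) =
      t • (Pi.single 2 1 ᵥ* ((g⁻¹ : SL3R) : Mat3)) := by
    have h1 := congrArg (· ᵥ* ((g⁻¹ : SL3R) : Mat3)) ht
    simp only [vecMul_vecMul, ← Matrix.SpecialLinearGroup.coe_mul, mul_inv_cancel,
      Matrix.SpecialLinearGroup.coe_one, vecMul_one, smul_vecMul] at h1
    rw [← h1, hq, hf₀, _root_.mul_inv_rev, Matrix.SpecialLinearGroup.coe_mul, vecMul_vecMul]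
  have hd : d ≠ 0 := by
    rintro rfl
    apply hqz0
    simp [hq]
  refine mk_eq_mk_of_flag (c := c) (d := d⁻¹ * t) hcol0 ?_
  rw [mul_smul, ← ht', smul_smul, inv_mul_cancel₀ hd, one_smul]

/-! ### Cartan projections, word length and the Anosov condition. -/

/-- The sum of the squares of the entries of a real matrix. -/
def sumSq (M : Mat3) : ℝ := ∑ i, ∑ j, M i j ^ 2

theorem sumSq_eq_trace (M : Mat3) : sumSq M = (Mᵀ * M).trace := by
  simp only [sumSq, trace, diag, mul_apply, transpose_apply, sq]
  exact Finset.sum_comm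

theorem sumSq_orthogonal_mul_mul {k₁ k₂ M : Mat3} (h₁ : k₁ᵀ * k₁ = 1) (h₂ : k₂ * k₂ᵀ = 1) :
    sumSq (k₁ * M * k₂) = sumSq M := by
  rw [sumSq_eq_trace, sumSq_eq_trace]
  have : (k₁ * M * k₂)ᵀ * (k₁ * M * k₂) = k₂ᵀ * (Mᵀ * (k₁ᵀ * k₁) * M * k₂) := by
    simp only [transpose_mul, Matrix.mul_assoc]
  rw [this, h₁, trace_mul_comm, Matrix.mul_one, Matrix.mul_assoc, h₂, Matrix.mul_one]

theorem sumSq_diagonal (d : Fin 3 → ℝ) : sumSq (diagonal d) = ∑ i, d i ^ 2 := by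
  simp [sumSq, diagonal_apply, Finset.sum_ite_eq, ite_pow]

/-- The Frobenius norm is invariant under orthogonal factors on both sides, so only exp(H),
respectively exp(−H), contributes. -/
theorem IsCartanProjection.sumSq_eq {g : SL3R} {H : Fin 3 → ℝ} (h : IsCartanProjection g H) :
    sumSq g = ∑ i, Real.exp (2 * H i) ∧
      sumSq ((g⁻¹ : SL3R) : Mat3) = ∑ i, Real.exp (-(2 * H i)) := by
  obtain ⟨-, -, k₁, hk₁, k₂, hk₂, hg⟩ := h
  rw [Matrix.mem_specialOrthogonalGroup_iff] at hk₁ hk₂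
  have h1 : k₁ᵀ * k₁ = 1 := by
    simpa [Matrix.star_eq_conjTranspose] using (Matrix.mem_orthogonalGroup_iff' ..).1 hk₁.1
  have h1' : k₁ * k₁ᵀ = 1 := mul_eq_one_comm.1 h1
  have h2 : k₂ * k₂ᵀ = 1 := by
    simpa [Matrix.star_eq_conjTranspose] using (Matrix.mem_orthogonalGroup_iff ..).1 hk₂.1
  have h2' : k₂ᵀ * k₂ = 1 := mul_eq_one_comm.1 h2
  constructor
  · rw [hg, sumSq_orthogonal_mul_mul h1 h2, sumSq_diagonal]
    refine Finset.sum_congr rfl fun i _ => ?_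
    rw [two_mul, Real.exp_add, sq]
  · set D : Mat3 := diagonal fun i => Real.exp (H i)
    set D' : Mat3 := diagonal fun i => Real.exp (-H i) with hD'
    have hDD : D * D' = 1 := by
      rw [diagonal_mul_diagonal]
      simp [← Real.exp_add]
    have hinv : ((g⁻¹ : SL3R) : Mat3) = k₂ᵀ * D' * k₁ᵀ := by
      have hr : (g : Mat3) * (k₂ᵀ * D' * k₁ᵀ) = 1 := by
        rw [hg]
        calc k₁ * D * k₂ * (k₂ᵀ * D' * k₁ᵀ) = k₁ * (D * (k₂ * k₂ᵀ) * D') * k₁ᵀ := by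
              simp only [Matrix.mul_assoc]
          _ = 1 := by rw [h2, Matrix.mul_one, hDD, Matrix.mul_one, h1']
      have hl : ((g⁻¹ : SL3R) : Mat3) * (g : Mat3) = 1 := by
        rw [← Matrix.SpecialLinearGroup.coe_mul, inv_mul_cancel, Matrix.SpecialLinearGroup.coe_one]
      exact left_inv_eq_right_inv hl hr
    rw [hinv, sumSq_orthogonal_mul_mul (by rwa [transpose_transpose])
      (by rwa [transpose_transpose]), hD', sumSq_diagonal]
    refine Finset.sum_congr rfl fun i _ => ?_
    rw [two_mul, neg_add, Real.exp_add, sq]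

/-- The second simple root of the Cartan projection is controlled by the sizes of `g` and `g⁻¹`. -/
theorem exp_simpleRoot_one_le (g : SL3R) :
    Real.exp (2 * simpleRoot 1 (cartanProjection g)) * sumSq g ≤
      3 * sumSq ((g⁻¹ : SL3R) : Mat3) ^ 2 := by
  have hspec := cartanProjection_spec g
  set H := cartanProjection g
  obtain ⟨e1, e2⟩ := hspec.sumSq_eq
  obtain ⟨hanti, hsum, -⟩ := hspec
  have h01 : H 1 ≤ H 0 := hanti (by decide)
  have h02 : H 2 ≤ H 0 := hanti (by decide)
  rw [Fin.sum_univ_three] at e1 e2 hsum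
  have b1 : sumSq g ≤ 3 * Real.exp (2 * H 0) := by
    rw [e1]
    have := Real.exp_le_exp.2 (show 2 * H 1 ≤ 2 * H 0 by linarith)
    have := Real.exp_le_exp.2 (show 2 * H 2 ≤ 2 * H 0 by linarith)
    linarith
  have b2 : Real.exp (-(2 * H 2)) ≤ sumSq ((g⁻¹ : SL3R) : Mat3) := by
    rw [e2]
    have := Real.exp_pos (-(2 * H 0))
    have := Real.exp_pos (-(2 * H 1))
    linarith
  have hroot : simpleRoot 1 H = H 1 - H 2 := rfl
  calc Real.exp (2 * simpleRoot 1 H) * sumSq g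
      ≤ Real.exp (2 * simpleRoot 1 H) * (3 * Real.exp (2 * H 0)) := by gcongr
    -- Trace zero gives 2(H 1 − H 2) + 2H 0 = −4H 2.
    _ = 3 * Real.exp (-(2 * H 2)) ^ 2 := by
      rw [hroot, ← Real.exp_nat_mul, mul_left_comm, ← Real.exp_add]
      congr 2
      push_cast
      linarith
    _ ≤ 3 * sumSq ((g⁻¹ : SL3R) : Mat3) ^ 2 := by gcongr

/-- Balls for the word length are finite. -/
theorem finite_wordLength_le {G : Type*} [Group G] (S : Finset G)
    (hS : Subgroup.closure (S : Set G) = ⊤) (N : ℕ) :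
    {γ : G | wordLength (S : Set G) γ ≤ N}.Finite := by
  classical
  set T : Set G := (S : Set G) ∪ (S : Set G)⁻¹ with hT
  have hTf : T.Finite := S.finite_toSet.union S.finite_toSet.inv
  have : Finite T := hTf
  have hfin : {L : List T | L.length ≤ N}.Finite := List.finite_length_le T N
  refine (hfin.image fun L => (L.map Subtype.val).prod).subset ?_
  intro γ hγ
  -- Generation is needed here: for an element that is no word in S, `sInf ∅ = 0` would report a
  -- small length.
  have hne : {n : ℕ | ∃ L : List G, L.length = n ∧ (∀ x ∈ L, x ∈ (S : Set G) ∨ x⁻¹ ∈ (S : Set G)) ∧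
      L.prod = γ}.Nonempty := by
    have hγ : γ ∈ Subgroup.closure (S : Set G) := by rw [hS]; trivial
    rw [← Subgroup.mem_toSubmonoid, Subgroup.closure_toSubmonoid] at hγ
    obtain ⟨L, hL, hp⟩ := Submonoid.exists_list_of_mem_closure hγ
    exact ⟨L.length, L, rfl, hL, hp⟩
  obtain ⟨L, hlen, hL, hp⟩ := Nat.sInf_mem hne
  have hLT : ∀ x ∈ L, x ∈ T := fun x hx => by
    simpa [hT] using hL x hx
  refine ⟨L.attach.map fun x => ⟨x.1, hLT x.1 x.2⟩, ?_, ?_⟩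
  · simp only [Set.mem_ofPred_eq, List.length_map, List.length_attach]
    rw [hlen]
    exact hγ
  · simp only [List.map_map, Function.comp_def]
    rw [← hp, List.attach_map_subtype_val]

variable {Γ : Subgroup SL3R} {w : SL3R} {l : ℝ} {μ : ℂ}

theorem SpiralCoords.pow_ne_one (C : SpiralCoords w l μ) (hl : 1 < l) {n : ℕ} (hn : n ≠ 0) :
    w ^ n ≠ 1 := by
  intro h
  have h1 := C.vec_pow_mulVec n C.axis
  rw [h, Matrix.SpecialLinearGroup.coe_one, one_mulVec, C.vec_axis] at h1
  have h2 : (1 : ℝ) = l ^ n := by simpa using congrArg Prod.fst h1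
  exact (one_lt_pow₀ hl hn).ne h2

theorem sq_mulVec_le (M : Mat3) (x : Fin 3 → ℝ) (i : Fin 3) :
    (M *ᵥ x) i ^ 2 ≤ sumSq M * ∑ j, x j ^ 2 := by
  calc (M *ᵥ x) i ^ 2 ≤ (∑ j, M i j ^ 2) * ∑ j, x j ^ 2 :=
        Finset.sum_mul_sq_le_sq_mul_sq Finset.univ (fun j => M i j) x
    _ ≤ sumSq M * ∑ j, x j ^ 2 := by
      gcongr
      exact Finset.single_le_sum (f := fun i => ∑ j, M i j ^ 2)
        (fun _ _ => Finset.sum_nonneg fun _ _ => sq_nonneg _) (Finset.mem_univ i)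

/-- The axis is stretched by lⁿ, and Cauchy–Schwarz turns this into a lower bound for the norm. -/
theorem SpiralCoords.le_sumSq_pow (C : SpiralCoords w l μ) :
    ∃ c : ℝ, 0 < c ∧ ∀ n : ℕ, c * (l ^ n) ^ 2 ≤ sumSq ((w ^ n : SL3R) : Mat3) := by
  obtain ⟨i, hi⟩ := Function.ne_iff.1 C.axis_ne_zero
  have hi' : 0 < C.axis i ^ 2 := by
    have : C.axis i ≠ 0 := hi
    positivity
  have hs : 0 < ∑ j, C.axis j ^ 2 :=
    lt_of_lt_of_le hi' (Finset.single_le_sum (f := fun j => C.axis j ^ 2)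
      (fun _ _ => sq_nonneg _) (Finset.mem_univ i))
  refine ⟨C.axis i ^ 2 / ∑ j, C.axis j ^ 2, by positivity, fun n => ?_⟩
  have hax : ((w ^ n : SL3R) : Mat3) *ᵥ C.axis = l ^ n • C.axis := by
    apply C.vec.injective
    rw [C.vec_pow_mulVec, map_smul, C.vec_axis]
    ext1 <;> simp
  have h := sq_mulVec_le ((w ^ n : SL3R) : Mat3) C.axis i
  rw [hax, Pi.smul_apply, smul_eq_mul, mul_pow] at h
  rw [div_mul_eq_mul_div, div_le_iff₀ hs]
  linarith

/-- In the adapted coordinates w⁻ⁿ has norm at most |μ|⁻ⁿ, as |l|⁻¹ ≤ |μ|⁻¹; changing coordinates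
costs a constant. -/
theorem SpiralCoords.sumSq_pow_inv_le (C : SpiralCoords w l μ) (hl : l ≠ 0) (hμ0 : μ ≠ 0)
    (hlμ : ‖μ‖ ≤ |l|) :
    ∃ c : ℝ, 0 < c ∧ ∀ n : ℕ, sumSq (((w ^ n)⁻¹ : SL3R) : Mat3) ≤ c * (‖μ‖⁻¹ ^ n) ^ 2 := by
  have hn : 0 < ‖μ‖ := norm_pos_iff.2 hμ0
  set A := ‖(C.vec.symm : ℝ × ℂ →L[ℝ] (Fin 3 → ℝ))‖
  refine ⟨∑ i : Fin 3, ∑ j : Fin 3, (A * ‖C.vec (Pi.single j 1)‖) ^ 2 + 1, by positivity,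
    fun n => ?_⟩
  have hentry : ∀ i j, |(((w ^ n)⁻¹ : SL3R) : Mat3) i j| ≤
      (A * ‖C.vec (Pi.single j 1)‖) * ‖μ‖⁻¹ ^ n := by
    intro i j
    set x : Fin 3 → ℝ := Pi.single j 1
    have h1 : ‖C.vec ((((w ^ n)⁻¹ : SL3R) : Mat3) *ᵥ x)‖ ≤ ‖μ‖⁻¹ ^ n * ‖C.vec x‖ := by
      rw [C.vec_pow_inv_mulVec hl hμ0, Prod.norm_mk]
      refine max_le ?_ ?_
      · rw [norm_mul, norm_pow, norm_inv, Real.norm_eq_abs l]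
        gcongr
        exact norm_fst_le _
      · rw [norm_mul, norm_pow, norm_inv]
        gcongr
        exact norm_snd_le _
    have h2 : ‖(((w ^ n)⁻¹ : SL3R) : Mat3) *ᵥ x‖ ≤
        A * ‖C.vec ((((w ^ n)⁻¹ : SL3R) : Mat3) *ᵥ x)‖ := by
      have := (C.vec.symm : ℝ × ℂ →L[ℝ] (Fin 3 → ℝ)).le_opNorm
        (C.vec ((((w ^ n)⁻¹ : SL3R) : Mat3) *ᵥ x))
      simpa using this
    have h3 : |(((w ^ n)⁻¹ : SL3R) : Mat3) i j| ≤ ‖(((w ^ n)⁻¹ : SL3R) : Mat3) *ᵥ x‖ := by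
      have := norm_le_pi_norm ((((w ^ n)⁻¹ : SL3R) : Mat3) *ᵥ x) i
      have e := congrFun (mulVec_single_one_eq_col (((w ^ n)⁻¹ : SL3R) : Mat3) j) i
      rw [Real.norm_eq_abs, e] at this
      exact this
    calc _ ≤ _ := h3
      _ ≤ _ := h2
      _ ≤ A * (‖μ‖⁻¹ ^ n * ‖C.vec x‖) := by gcongr
      _ = _ := by ring
  calc sumSq (((w ^ n)⁻¹ : SL3R) : Mat3)
      ≤ ∑ i : Fin 3, ∑ j : Fin 3, ((A * ‖C.vec (Pi.single j 1)‖) * ‖μ‖⁻¹ ^ n) ^ 2 := by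
        refine Finset.sum_le_sum fun i _ => Finset.sum_le_sum fun j _ => ?_
        rw [← sq_abs]
        gcongr
        exact hentry i j
    _ = (∑ i : Fin 3, ∑ j : Fin 3, (A * ‖C.vec (Pi.single j 1)‖) ^ 2) * (‖μ‖⁻¹ ^ n) ^ 2 := by
        simp only [mul_pow, Finset.sum_mul]
    _ ≤ _ := by
        gcongr
        linarith

/-- An Anosov subgroup of `SL(3, ℝ)` contains no element of infinite order with a nonreal
eigenvalue. -/
theorem SpiralCoords.not_isAnosov (C : SpiralCoords w l μ) (hw : w ∈ Γ) (hl : 1 < l)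
    (hdet : l * ‖μ‖ ^ 2 = 1) : ¬ IsAnosov Γ := by
  rintro ⟨S, hS, L, A, hL, hA, hbound⟩
  have hμ0 : μ ≠ 0 := by
    rintro rfl
    simp at hdet
  have hn : 0 < ‖μ‖ := norm_pos_iff.2 hμ0
  have hμ1 : ‖μ‖ ≤ 1 := by
    by_contra! h
    nlinarith [mul_self_nonneg (‖μ‖ - 1)]
  obtain ⟨c, hc, hlow⟩ := C.le_sumSq_pow
  obtain ⟨c', hc', hup⟩ := C.sumSq_pow_inv_le (by linarith) hμ0
    (hμ1.trans (hl.le.trans (le_abs_self l)))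
  -- Since |μ|⁻² = l, both sides of `exp_simpleRoot_one_le` at wⁿ are controlled by l²ⁿ. These
  -- powers cancel, leaving 3c'²/c.
  set K := Real.log (3 * c' ^ 2 / c) / 2 with hK
  have hroot : ∀ n : ℕ, simpleRoot 1 (cartanProjection (w ^ n)) ≤ K := by
    intro n
    have h1 := exp_simpleRoot_one_le (w ^ n)
    set E := Real.exp (2 * simpleRoot 1 (cartanProjection (w ^ n)))
    have hEpos : 0 < E := Real.exp_pos _
    have hln : 0 < l ^ n := by positivity
    have hnonneg : 0 ≤ sumSq (((w ^ n)⁻¹ : SL3R) : Mat3) :=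
      Finset.sum_nonneg fun _ _ => Finset.sum_nonneg fun _ _ => sq_nonneg _
    have hinv : ‖μ‖⁻¹ ^ n * ‖μ‖⁻¹ ^ n = l ^ n := by
      rw [← mul_pow]
      congr 1
      field_simp
      linarith
    have h2 : E * (c * (l ^ n) ^ 2) ≤ 3 * (c' * l ^ n) ^ 2 := by
      calc E * (c * (l ^ n) ^ 2) ≤ E * sumSq ((w ^ n : SL3R) : Mat3) := by
            gcongr
            exact hlow n
        _ ≤ _ := h1
        _ ≤ 3 * (c' * (‖μ‖⁻¹ ^ n) ^ 2) ^ 2 := by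
            gcongr
            exact hup n
        _ = _ := by rw [sq (‖μ‖⁻¹ ^ n), hinv]
    have h3 : E ≤ 3 * c' ^ 2 / c := by
      rw [le_div_iff₀ hc]
      have h4 : 0 < (l ^ n) ^ 2 := by positivity
      refine le_of_mul_le_mul_right ?_ h4
      linarith
    have h5 := (Real.le_log_iff_exp_le (by positivity)).2 h3
    rw [hK]
    linarith
  obtain ⟨N, hN⟩ := exists_nat_ge (L * (K + A))
  have hLpos : 0 < L := by linarith
  let W : ℕ → Γ := fun n => ⟨w, hw⟩ ^ n
  have hWmem : ∀ n, W n ∈ {γ : Γ | wordLength (S : Set Γ) γ ≤ N} := by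
    intro n
    have h1 := hbound 1 (W n)
    have h2 : ((W n : Γ) : SL3R) = w ^ n := by simp [W]
    rw [h2] at h1
    have h3 : 1 / L * (wordLength (S : Set Γ) (W n) : ℝ) ≤ K + A := by linarith [hroot n]
    rw [one_div, inv_mul_le_iff₀ hLpos] at h3
    have h4 : (wordLength (S : Set Γ) (W n) : ℝ) ≤ N := h3.trans hN
    exact_mod_cast h4
  have hinj : Function.Injective W := by
    rw [injective_pow_iff_not_isOfFinOrder, isOfFinOrder_iff_pow_eq_one]
    rintro ⟨n, hn0, h⟩
    apply C.pow_ne_one hl hn0.ne'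
    have := congrArg (Subtype.val : Γ → SL3R) h
    simpa using this
  exact Set.infinite_of_injective_forall_mem hinj hWmem (finite_wordLength_le S hS N)

/-! ### The explicit group: relations, the word, irreducibility. -/

theorem matA_pow_three : matA ^ 3 = 1 := by
  apply Subtype.ext
  decide

theorem matB_pow_three : matB ^ 3 = 1 := by
  apply Subtype.ext
  decide

theorem matA_mul_matB_pow_four : (matA * matB) ^ 4 = 1 := by
  apply Subtype.ext
  decide

theorem word18_norm : word18.norm = 18 := by
  decide

theorem exists_triangleGroup_hom :
    ∃ ρ : TriangleGroup334 →* Matrix.SpecialLinearGroup (Fin 3) ℤ,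
      ρ (PresentedGroup.of 0) = matA ∧ ρ (PresentedGroup.of 1) = matB ∧ ρ.range = groupAB := by
  have h : ∀ r ∈ triangleRels, FreeGroup.lift ![matA, matB] r = 1 := by
    rintro r (rfl | rfl | rfl)
    · simpa using matA_pow_three
    · simpa using matB_pow_three
    · simpa using matA_mul_matB_pow_four
  refine ⟨PresentedGroup.toGroup h, by simp, by simp, ?_⟩
  rw [MonoidHom.range_eq_map, ← PresentedGroup.closure_range_of, MonoidHom.map_closure, groupAB]
  congr 1
  ext x
  simp [Fin.exists_fin_two, eq_comm]

/-- The element `w` of the group as an explicit matrix. -/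
def wordMatrix : Matrix (Fin 3) (Fin 3) ℤ :=
  !![-81930761, 250889200, 48870138; -252848956, 774276615, 150819585;
    149140284, -456698877, -88959338]

theorem coe_evalAB_word18 : (evalAB word18 : Matrix (Fin 3) (Fin 3) ℤ) = wordMatrix := by
  have hA : matA⁻¹ = matA ^ 2 :=
    inv_eq_of_mul_eq_one_right (by rw [← pow_succ', matA_pow_three])
  have hB : matB⁻¹ = matB ^ 2 :=
    inv_eq_of_mul_eq_one_right (by rw [← pow_succ', matB_pow_three])
  -- With X = ba⁻¹ and Y = b⁻¹a the word is X⁴YX²YX.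
  have hX : ((matB * matA⁻¹ : Matrix.SpecialLinearGroup (Fin 3) ℤ) : Matrix (Fin 3) (Fin 3) ℤ) =
      !![-2, 5, 1; -5, 15, 3; 3, -9, -2] := by
    rw [hA]; decide
  have hY : ((matB⁻¹ * matA : Matrix.SpecialLinearGroup (Fin 3) ℤ) : Matrix (Fin 3) (Fin 3) ℤ) =
      !![1, -2, 0; 2, -6, -1; -3, 3, -2] := by
    rw [hB]; decide
  have hw : evalAB word18 = ((matB * matA⁻¹) * (matB * matA⁻¹)) * ((matB * matA⁻¹) * (matB * matA⁻¹))
      * ((matB⁻¹ * matA) * (((matB * matA⁻¹) * (matB * matA⁻¹)) *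
        ((matB⁻¹ * matA) * (matB * matA⁻¹)))) := by
    simp only [evalAB, word18, map_mul, map_inv, FreeGroup.lift_apply_of, cons_val]
    group
  rw [hw]
  simp only [Matrix.SpecialLinearGroup.coe_mul (_ * _), hX, hY]
  decide

theorem groupAB_mem : matA ∈ groupAB ∧ matB ∈ groupAB :=
  ⟨Subgroup.subset_closure (by simp), Subgroup.subset_closure (by simp)⟩

theorem evalAB_mem (x : FreeGroup (Fin 2)) : evalAB x ∈ groupAB := by
  induction x using FreeGroup.induction_on with
  | C1 => rw [map_one]; exact groupAB.one_mem
  | of i =>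
    fin_cases i
    · simpa [evalAB] using groupAB_mem.1
    · simpa [evalAB] using groupAB_mem.2
  | inv_of i h => rw [map_inv]; exact groupAB.inv_mem h
  | mul x y hx hy => rw [map_mul]; exact groupAB.mul_mem hx hy

theorem coe_inclSL3Z (g : Matrix.SpecialLinearGroup (Fin 3) ℤ) :
    ((inclSL3Z g : SL3R) : Mat3) = (g : Matrix (Fin 3) (Fin 3) ℤ).map (Int.cast : ℤ → ℝ) := rfl

/-- The group acts irreducibly, in the strong sense that no nonzero matrix coefficient vanishes
identically. -/
theorem groupAB_irreducible (x y : Fin 3 → ℝ)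
    (h : ∀ γ ∈ groupAB.map inclSL3Z, x ⬝ᵥ ((γ : Mat3) *ᵥ y) = 0) : x = 0 ∨ y = 0 := by
  set Γ := groupAB.map inclSL3Z
  set a := inclSL3Z matA
  set b := inclSL3Z matB
  have ha : a ∈ Γ := Subgroup.mem_map_of_mem _ groupAB_mem.1
  have hb : b ∈ Γ := Subgroup.mem_map_of_mem _ groupAB_mem.2
  have ea : (a : Mat3) = !![1, 1, 2; 0, 1, 1; 0, -3, -2] := by
    rw [coe_inclSL3Z]; ext i j; fin_cases i <;> fin_cases j <;> simp [matA]
  have eb : (b : Mat3) = !![-2, 0, -1; -5, 1, -1; 3, 0, 1] := by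
    rw [coe_inclSL3Z]; ext i j; fin_cases i <;> fin_cases j <;> simp [matB]
  -- As a³ = 1 with a simple eigenvalue 1, the sum 1 + a + a² has rank one: it is the column e₁
  -- times the row (3, −3, 1). Inserting it between two group elements splits a vanishing matrix
  -- coefficient into a product.
  have hN : ∀ z z' : Fin 3 → ℝ, z ⬝ᵥ z' + z ⬝ᵥ ((a : Mat3) *ᵥ z') +
      z ⬝ᵥ ((a : Mat3) *ᵥ ((a : Mat3) *ᵥ z')) = z 0 * (3 * z' 0 - 3 * z' 1 + z' 2) := by
    intro z z'
    rw [ea]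
    simp only [dotProduct, mulVec, Fin.sum_univ_three, of_apply, cons_val]
    ring
  have hprod : ∀ g₁ ∈ Γ, ∀ g₂ ∈ Γ, (x ᵥ* (g₁ : Mat3)) 0 *
      (3 * ((g₂ : Mat3) *ᵥ y) 0 - 3 * ((g₂ : Mat3) *ᵥ y) 1 + ((g₂ : Mat3) *ᵥ y) 2) = 0 := by
    intro g₁ h₁ g₂ h₂
    rw [← hN]
    have e1 := h _ (Γ.mul_mem h₁ h₂)
    have e2 := h _ (Γ.mul_mem h₁ (Γ.mul_mem ha h₂))
    have e3 := h _ (Γ.mul_mem h₁ (Γ.mul_mem ha (Γ.mul_mem ha h₂)))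
    simp only [Matrix.SpecialLinearGroup.coe_mul, ← mulVec_mulVec, dotProduct_mulVec x] at e1 e2 e3
    rw [e1, e2, e3]
    norm_num
  by_cases hx : ∀ g₁ ∈ Γ, (x ᵥ* (g₁ : Mat3)) 0 = 0
  · left
    -- The vectors e₁, be₁ and abe₁ span ℝ³.
    have e1 := hx 1 Γ.one_mem
    have e2 := hx b hb
    have e3 := hx (a * b) (Γ.mul_mem ha hb)
    simp only [Matrix.SpecialLinearGroup.coe_mul, Matrix.SpecialLinearGroup.coe_one, vecMul_one,
      ← vecMul_vecMul, ea, eb] at e1 e2 e3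
    simp only [vecMul, dotProduct, Fin.sum_univ_three, of_apply, cons_val] at e1 e2 e3
    funext i
    fin_cases i <;> simp only [Fin.zero_eta, Fin.mk_one, Fin.reduceFinMk, Pi.zero_apply] <;>
      linarith
  · right
    push Not at hx
    obtain ⟨g₁, h₁, hne⟩ := hx
    have hy : ∀ g₂ ∈ Γ, 3 * ((g₂ : Mat3) *ᵥ y) 0 - 3 * ((g₂ : Mat3) *ᵥ y) 1 +
        ((g₂ : Mat3) *ᵥ y) 2 = 0 := fun g₂ h₂ => (mul_eq_zero.1 (hprod g₁ h₁ g₂ h₂)).resolve_left hne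
    -- The row (3, −3, 1) and its images under b and b² span the dual space.
    have e1 := hy 1 Γ.one_mem
    have e2 := hy b hb
    have e3 := hy (b * b) (Γ.mul_mem hb hb)
    simp only [Matrix.SpecialLinearGroup.coe_mul, Matrix.SpecialLinearGroup.coe_one, one_mulVec,
      ← mulVec_mulVec, eb] at e1 e2 e3
    simp only [mulVec, dotProduct, Fin.sum_univ_three, of_apply, cons_val] at e1 e2 e3
    funext i
    fin_cases i <;> simp only [Fin.zero_eta, Fin.mk_one, Fin.reduceFinMk, Pi.zero_apply] <;>
      linarith

/-! ### The spectrum of w. -/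

/-- The roots of the characteristic polynomial of `wordMatrix`. -/
theorem exists_roots : ∃ (l : ℝ) (μ : ℂ), 1 < l ∧ μ.im ≠ 0 ∧ l + 2 * μ.re = (603386516 : ℤ) ∧
    2 * l * μ.re + Complex.normSq μ = (3386 : ℤ) ∧ l * Complex.normSq μ = 1 ∧
    l ^ 3 - 603386516 * l ^ 2 + 3386 * l - 1 = 0 ∧
    μ ^ 3 - 603386516 * μ ^ 2 + 3386 * μ - 1 = 0 := by
  obtain ⟨l, ⟨hl1, hl2⟩, hroot⟩ : (0 : ℝ) ∈ (fun x : ℝ => x ^ 3 - 603386516 * x ^ 2 + 3386 * x - 1) ''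
      Set.Icc 603386515 603386516 := by
    apply intermediate_value_Icc (by norm_num) (by fun_prop)
    constructor <;> norm_num
  simp only at hroot
  have hl0 : 0 < l := by linarith
  -- The other two roots have sum 2c and product 1/l, so they are nonreal exactly when c² < 1/l. The
  -- cubic gives 2cl = 3386 − 1/l, hence c²l ≤ 3386²/(4l), which is far below 1.
  set c : ℝ := (603386516 - l) / 2 with hc
  have hc0 : 0 ≤ c := by rw [hc]; linarith
  have hcl : 2 * c * l ≤ 3386 := by
    have h1 : l * (2 * c * l) = 3386 * l - 1 := by rw [hc]; linear_combination -hroot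
    nlinarith
  have hcc : c ^ 2 < 1 / l := by
    rw [lt_div_iff₀ hl0]
    have h1 : (2 * c * l) ^ 2 ≤ 3386 ^ 2 := by gcongr
    have h2 : 4 * l * (c ^ 2 * l) ≤ 3386 ^ 2 := by linarith
    by_contra! h3
    nlinarith
  set d : ℝ := Real.sqrt (1 / l - c ^ 2) with hd
  have hd2 : d ^ 2 = 1 / l - c ^ 2 := Real.sq_sqrt (by linarith)
  have hd0 : d ≠ 0 := (Real.sqrt_pos.2 (by linarith)).ne'
  have hnorm : Complex.normSq ⟨c, d⟩ = 1 / l := by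
    rw [Complex.normSq_mk, ← sq, ← sq, hd2]; ring
  have hl1' : l * (1 / l) = 1 := mul_one_div_cancel hl0.ne'
  have hlinv : 1 / l = l ^ 2 - 603386516 * l + 3386 := by
    rw [div_eq_iff hl0.ne']; linear_combination -hroot
  refine ⟨l, ⟨c, d⟩, by linarith, hd0, ?_, ?_, ?_, hroot, ?_⟩
  · simp only [hc]; push_cast; ring
  · rw [hnorm, hlinv]; simp only [hc]; push_cast; ring
  · rw [hnorm, hl1']
  · have hd2' : d ^ 2 = l ^ 2 - 603386516 * l + 3386 - c ^ 2 := by rw [hd2, hlinv]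
    have hl : l = 603386516 - 2 * c := by rw [hc]; ring
    have hq : (⟨c, d⟩ : ℂ) ^ 2 - 2 * c * ⟨c, d⟩ + (c ^ 2 + d ^ 2 : ℝ) = 0 := by
      apply Complex.ext
      · simp [sq]; ring
      · simp [sq]; ring
    have hn : ((c ^ 2 + d ^ 2 : ℝ) : ℂ) = l ^ 2 - 603386516 * l + 3386 := by
      rw [hd2']; push_cast; ring
    rw [hn] at hq
    have hrootC : (l : ℂ) ^ 3 - 603386516 * l ^ 2 + 3386 * l - 1 = 0 := by exact_mod_cast hroot
    have hlC : (2 : ℂ) * c = 603386516 - l := by rw [hl]; push_cast; ring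
    rw [hlC] at hq
    linear_combination ((⟨c, d⟩ : ℂ) - l) * hq + hrootC

/-- A left eigenvector of `wordMatrix` for the eigenvalue `x`. -/
def leftEigenvector {K : Type*} [CommRing K] (x : K) : Fin 3 → K :=
  ![x ^ 2 - 685317277 * x - 174825, 250889200 * x - 85426, 48870138 * x - 240870]

/-- The vector is the first row of the adjugate of x − W, with W = `wordMatrix`. Times x − W it
gives the characteristic polynomial at x in the first entry and 0 elsewhere, so only the first
column needs the cubic. -/
theorem leftEigenvector_vecMul {K : Type*} [CommRing K] {x : K}
    (hx : x ^ 3 - 603386516 * x ^ 2 + 3386 * x - 1 = 0) :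
    leftEigenvector x ᵥ* wordMatrix.map (Int.cast : ℤ → K) = x • leftEigenvector x := by
  funext j
  fin_cases j
  · simp [leftEigenvector, wordMatrix, vecMul, dotProduct, Fin.sum_univ_three]
    linear_combination -hx
  · simp [leftEigenvector, wordMatrix, vecMul, dotProduct, Fin.sum_univ_three]
    ring
  · simp [leftEigenvector, wordMatrix, vecMul, dotProduct, Fin.sum_univ_three]
    ring

theorem nonempty_spiralCoords {w : SL3R} (hw : (w : Mat3) = wordMatrix.map (Int.cast : ℤ → ℝ))
    {l : ℝ} {μ : ℂ} (him : μ.im ≠ 0) (hl : l ^ 3 - 603386516 * l ^ 2 + 3386 * l - 1 = 0)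
    (hμ : μ ^ 3 - 603386516 * μ ^ 2 + 3386 * μ - 1 = 0) : Nonempty (SpiralCoords w l μ) := by
  let Φ : (Fin 3 → ℝ) →ₗ[ℝ] ℝ × ℂ :=
    { toFun := fun v => (leftEigenvector l ⬝ᵥ v, leftEigenvector μ ⬝ᵥ fun i => (v i : ℂ))
      map_add' := by
        intro v v'
        ext1
        · simp [dotProduct_add]
        · simp [dotProduct, Fin.sum_univ_three]; ring
      map_smul' := by
        intro c v
        ext1
        · simp [dotProduct_smul]
        · simp [dotProduct, Fin.sum_univ_three]; ring }
  have hΦ : ∀ v, Φ ((w : Mat3) *ᵥ v) = (l * (Φ v).1, μ * (Φ v).2) := by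
    intro v
    have h2 : (fun i => (((w : Mat3) *ᵥ v) i : ℂ)) =
        wordMatrix.map (Int.cast : ℤ → ℂ) *ᵥ fun i => (v i : ℂ) := by
      funext i
      rw [hw]
      simp [mulVec, dotProduct, Fin.sum_univ_three]
    simp only [Φ, LinearMap.coe_mk, AddHom.coe_mk]
    rw [h2, hw, dotProduct_mulVec, dotProduct_mulVec, leftEigenvector_vecMul hl,
      leftEigenvector_vecMul hμ, smul_dotProduct, smul_dotProduct, smul_eq_mul, smul_eq_mul]
  have hinj : Function.Injective Φ := by
    rw [injective_iff_map_eq_zero]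
    intro v hv
    have h1 : leftEigenvector l ⬝ᵥ v = 0 := congrArg Prod.fst hv
    have h2 : (leftEigenvector μ ⬝ᵥ fun i => (v i : ℂ)) = 0 := congrArg Prod.snd hv
    -- Both coordinates of Φ v are values, at l and at μ, of the real quadratic v₀X² + BX + D.
    -- Vanishing at a real and a nonreal point forces it to be zero.
    set B := -685317277 * v 0 + 250889200 * v 1 + 48870138 * v 2 with hB
    set D := -174825 * v 0 - 85426 * v 1 - 240870 * v 2 with hD
    have h1' : v 0 * l ^ 2 + B * l + D = 0 := by
      rw [← h1, hB, hD]
      simp only [leftEigenvector, dotProduct, Fin.sum_univ_three, cons_val]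
      ring
    have h2' : (v 0 : ℂ) * μ ^ 2 + B * μ + D = 0 := by
      rw [← h2, hB, hD]
      simp only [leftEigenvector, dotProduct, Fin.sum_univ_three, cons_val]
      push_cast
      ring
    have hre := congrArg Complex.re h2'
    have hi := congrArg Complex.im h2'
    simp [sq] at hre hi
    have hB2 : B = -2 * μ.re * v 0 := by
      apply mul_right_cancel₀ him
      linear_combination hi
    have hv0 : v 0 = 0 := by
      have h3 : v 0 * ((l - μ.re) ^ 2 + μ.im ^ 2) = 0 := by
        rw [hB2] at h1' hre
        linear_combination h1' - hre
      have h4 : (l - μ.re) ^ 2 + μ.im ^ 2 ≠ 0 := by positivity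
      exact (mul_eq_zero.1 h3).resolve_right h4
    have hB0 : B = 0 := by rw [hB2, hv0, mul_zero]
    have hD0 : D = 0 := by rw [hv0, hB0] at h1'; linarith
    rw [hB0, hv0] at hB
    rw [hD0, hv0] at hD
    funext i
    fin_cases i <;> simp only [Fin.zero_eta, Fin.mk_one, Fin.reduceFinMk, Pi.zero_apply] <;>
      linarith
  have hfin : Module.finrank ℝ (Fin 3 → ℝ) = Module.finrank ℝ (ℝ × ℂ) := by
    simp [Complex.finrank_real_complex]
  exact ⟨SpiralCoords.ofVec (LinearEquiv.ofInjectiveOfFinrankEq Φ hinj hfin).toContinuousLinearEquiv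
    hΦ⟩

theorem hasEigenvalue_wordMatrix {z : ℂ} (hz : z ^ 3 - 603386516 * z ^ 2 + 3386 * z - 1 = 0) :
    Module.End.HasEigenvalue (Matrix.toLin' (wordMatrix.map (Int.cast : ℤ → ℂ))) z := by
  have hdet : (wordMatrix.map (Int.cast : ℤ → ℂ) - z • (1 : Matrix (Fin 3) (Fin 3) ℂ)).det = 0 := by
    rw [det_fin_three]
    simp [wordMatrix]
    linear_combination -hz
  obtain ⟨v, hv0, hv⟩ := exists_mulVec_eq_zero_iff.2 hdet
  refine Module.End.hasEigenvalue_of_hasEigenvector (x := v) ⟨?_, hv0⟩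
  rw [Module.End.mem_eigenspace_iff, toLin'_apply]
  rw [sub_mulVec, smul_mulVec, one_mulVec, sub_eq_zero] at hv
  exact hv

theorem proposition5p3 :
    (∃ ρ : TriangleGroup334 →* Matrix.SpecialLinearGroup (Fin 3) ℤ,
      ρ (PresentedGroup.of 0) = matA ∧ ρ (PresentedGroup.of 1) = matB ∧ ρ.range = groupAB) ∧
    MulAction.IsMinimal (groupAB.map inclSL3Z) FurstenbergBoundary ∧
    ¬ IsAnosov (groupAB.map inclSL3Z) ∧
    (word18.norm = 18 ∧ ¬ IsOfFinOrder (evalAB word18) ∧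
      ∃ z : ℂ, z.im ≠ 0 ∧
        Module.End.HasEigenvalue
          (Matrix.toLin' ((evalAB word18 : Matrix (Fin 3) (Fin 3) ℤ).map (Int.cast : ℤ → ℂ))) z) :=
  by
  obtain ⟨l, μ, hl1, him, hs, ht, hn, hl, hμ⟩ := exists_roots
  set w : SL3R := inclSL3Z (evalAB word18) with hw
  have hwcoe : (w : Mat3) = wordMatrix.map (Int.cast : ℤ → ℝ) := by
    rw [hw, coe_inclSL3Z, coe_evalAB_word18]
  have hwΓ : w ∈ groupAB.map inclSL3Z := Subgroup.mem_map_of_mem _ (evalAB_mem _)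
  obtain ⟨C⟩ := nonempty_spiralCoords hwcoe him hl hμ
  have hμ0 : μ ≠ 0 := by
    rintro rfl
    simp at him
  have hdet : l * ‖μ‖ ^ 2 = 1 := by rwa [← Complex.normSq_eq_norm_sq]
  have hlμ : ‖μ‖ < l := by
    by_contra! h
    nlinarith [norm_nonneg μ]
  have hrot : ∀ k : ℕ, 0 < k → (μ ^ k).im ≠ 0 := fun k hk => pow_im_ne_zero hl1 hs ht hn hk
  refine ⟨exists_triangleGroup_hom, ?_, C.not_isAnosov hwΓ hl1 hdet, word18_norm, ?_, μ, him, ?_⟩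
  · exact isMinimal_of_flag_mem fun hS _ _ h₀ hv₀ hf₀ hfv₀ _ _ hv hfv =>
      hS.flag_mem C hwΓ hμ0 hlμ hrot groupAB_irreducible h₀ hv₀ hf₀ hfv₀ hv hfv
  · rw [isOfFinOrder_iff_pow_eq_one]
    rintro ⟨n, hn0, h⟩
    apply C.pow_ne_one hl1 hn0.ne'
    rw [hw, ← map_pow, h, map_one]
  · rw [coe_evalAB_word18]
    exact hasEigenvalue_wordMatrix hμ
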